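/- Let $(X,\sigma)$ be a surjective multivariable dynamical system: $X$ is a locally compact Hausdorff space, $\sigma=(\sigma_1,\dots,\sigma_n)$ are proper continuous maps $X\to X$, and $X=\bigcup_{i=1}^n\sigma_i(X)$. Let $\tilde X=\{(\mathbf i,\mathbf x)\in\{1,\dots,n\}^{\mathbb N}\times X^{\mathbb N} : \sigma_{i_k}(x_{k+1})=x_k \text{ for all } k\ge 0\}$ with the relative product topology. Define $\tilde\sigma_i(\mathbf i,\mathbf x)=\big((i,i_0,i_1,\dots),(\sigma_i(x_0),x_0,x_1,\dots)\big)$ and $\tau(\mathbf i,\mathbf x)=\big((i_1,i_2,\dots),(x_1,x_2,\dots)\big)$, so that $\tau$ restricted to $\tilde\sigma_i(\tilde X)$ is $\tilde\sigma_i^{-1}$. For a word $w=i_1\cdots i_k$ in $\{1,\dots,n\}$ write $|w|=k$ and $\tilde\sigma_w=\tilde\sigma_{i_1}\circ\cdots\circ\tilde\sigma_{i_k}$. A subset $F\subseteq\tilde X$ is \emph{$\tau$-invariant} if $\tau(F)\subseteq F$, and \emph{robust} if $\tilde\sigma_w\tau^{|w|}(x)\in F$ for every $x\in F$ and every word $w$.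 For closed $F$ put $I_F=\{f\in \mathrm C_0(\tilde X): f|_F=0\}$. Let $\mathcal A(\tilde X,\tilde\sigma)$ be the tensor algebra of the system $(\tilde X,\tilde\sigma)$: the completion of the algebra of finite sums $\sum_w\mathfrak t_w f_w$ with $f_w\in \mathrm C_0(\tilde X)$, $\mathfrak t_w=\mathfrak t_{i_1}\cdots\mathfrak t_{i_k}$ and the relations $f\,\mathfrak t_i=\mathfrak t_i\,(f\circ\tilde\sigma_i)$, in the operator algebra (matrix) norms given by the supremum over all representations on Hilbert space that restrict to a $*$-representation of $\mathrm C_0(\tilde X)$ and make $[\mathfrak t_1\ \cdots\ \mathfrak t_n]$ a row contraction. Let $\mathfrak A$ be the C*-envelope of $\mathcal A(\tilde X,\tilde\sigma)$ (which is also the C*-envelope of $\mathcal A(X,\sigma)$): the C*-algebra generated by a completely isometric representation of it that is a quotient, compatibly with the representations, of the C*-algebra generated by any other completely isometric representation. In $\mathfrak A$ let \[ \mathfrak B=\overline{\operatorname{span}}\{\mathfrak t_u f\mathfrak t_v^* : |u|=|v|,\ f\in \mathrm C_0(\tilde X)\},\qquad \alpha(b)=\frac1n\sum_{i,j=1}^n\mathfrak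 t_i\,b\,\mathfrak t_j^*\quad(b\in\mathfrak B). \] Then the $\alpha$-invariant ideals of $\mathfrak B$ (closed two-sided ideals $\mathfrak J$ with $\alpha(\mathfrak J)\subseteq\mathfrak J$) are in bijective correspondence with the closed, robust, $\tau$-invariant subsets of $\tilde X$, via the map that sends $\mathfrak J$ to the unique closed set $F\subseteq\tilde X$ with $\mathfrak J\cap \mathrm C_0(\tilde X)=I_F$. -/

import Mathlib

open scoped ZeroAtInfty

universe u

noncomputable section

/-- A multivariable dynamical system: a tuple of `n` proper continuous self-maps of `X`.
(`IsProperMap` includes continuity.) -/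
structure MultiSystem (n : ℕ) (X : Type u) [TopologicalSpace X] where
  map : Fin n → X → X
  isProper : ∀ i, IsProperMap (map i)

namespace MultiSystem

variable {n : ℕ} {X : Type u} [TopologicalSpace X]

/-- The system is surjective: `X = ⋃ i, σ_i(X)`. -/
def IsSurjective (S : MultiSystem n X) : Prop :=
  (⋃ i, Set.range (S.map i)) = Set.univ

/-- `σ_w = σ_{i₁} ∘ ⋯ ∘ σ_{i_k}` for the word `w = i₁ ⋯ i_k`. -/
def wordMap (S : MultiSystem n X) (w : List (Fin n)) (x : X) : X :=
  w.foldr S.map x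

theorem tendsto_cocompact (S : MultiSystem n X) (i : Fin n) :
    Filter.Tendsto (S.map i) (Filter.cocompact X) (Filter.cocompact X) := by
  intro s hs
  obtain ⟨K, hK, hKs⟩ := Filter.mem_cocompact.1 hs
  refine Filter.mem_cocompact.2 ⟨S.map i ⁻¹' K, (S.isProper i).isCompact_preimage hK, ?_⟩
  intro x hx
  exact hKs hx

/-- `f ∘ σ_i` as an element of `C₀(X)`. -/
def pullback (S : MultiSystem n X) (i : Fin n) (f : C₀(X, ℂ)) : C₀(X, ℂ) :=
  f.comp { toFun := S.map i
           continuous_toFun := (S.isProper i).continuous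
           cocompact_tendsto' := S.tendsto_cocompact i }

/-! ### The covering system -/

/-- The space of infinite tails `(𝐢, 𝐱)` with `σ_{i_k}(x_{k+1}) = x_k`, with the topology induced
by the product topology (`Fin n` being discrete). -/
abbrev Tail (S : MultiSystem n X) : Type u :=
  {z : (ℕ → Fin n) × (ℕ → X) // ∀ k, S.map (z.1 k) (z.2 (k + 1)) = z.2 k}

/-- `(a, s₀, s₁, …)`. -/
def consSeq {α : Type*} (a : α) (s : ℕ → α) : ℕ → α
  | 0 => a
  | k + 1 => s k

/-- `σ̃_i (𝐢, 𝐱) = ((i, i₀, i₁, …), (σ_i(x₀), x₀, x₁, …))`. -/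
def tailMap (S : MultiSystem n X) (i : Fin n) (z : S.Tail) : S.Tail :=
  ⟨(consSeq i z.1.1, consSeq (S.map i (z.1.2 0)) z.1.2), by
    intro k
    cases k with
    | zero => rfl
    | succ k => exact z.2 k⟩

/-- `τ (𝐢, 𝐱) = ((i₁, i₂, …), (x₁, x₂, …))`; by the next two lemmas this is the map that restricts
to the inverse of `σ̃_i` on each `X̃_i = {(𝐢, 𝐱) | i₀ = i}`. -/
def shift (S : MultiSystem n X) (z : S.Tail) : S.Tail :=
  ⟨(fun k => z.1.1 (k + 1), fun k => z.1.2 (k + 1)), fun k => z.2 (k + 1)⟩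

theorem shift_tailMap (S : MultiSystem n X) (i : Fin n) (z : S.Tail) :
    S.shift (S.tailMap i z) = z := rfl

theorem tailMap_shift (S : MultiSystem n X) (z : S.Tail) :
    S.tailMap (z.1.1 0) (S.shift z) = z := by
  apply Subtype.ext
  refine Prod.ext ?_ ?_
  · funext k
    cases k <;> rfl
  · funext k
    cases k with
    | zero => exact z.2 0
    | succ k => rfl

theorem continuous_shift (S : MultiSystem n X) : Continuous S.shift := by
  unfold shift
  fun_prop

theorem continuous_tailMap (S : MultiSystem n X) (i : Fin n) : Continuous (S.tailMap i) := by
  refine Continuous.subtype_mk (Continuous.prodMk ?_ ?_) _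
  · refine continuous_pi fun k => ?_
    cases k with
    | zero => exact continuous_const
    | succ k =>
      change Continuous fun z : S.Tail => z.1.1 k
      fun_prop
  · refine continuous_pi fun k => ?_
    cases k with
    | zero =>
      change Continuous fun z : S.Tail => S.map i (z.1.2 0)
      exact (S.isProper i).continuous.comp (by fun_prop)
    | succ k =>
      change Continuous fun z : S.Tail => z.1.2 k
      fun_prop

/-- The covering system `(X̃, σ̃)`. -/
def cover [T2Space X] (S : MultiSystem n X) : MultiSystem n S.Tail where
  map := S.tailMap
  isProper i :=
    (Function.LeftInverse.isClosedEmbedding (S.shift_tailMap i) S.continuous_shift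
      (S.continuous_tailMap i)).isProperMap

/-- `F` is robust: it contains `σ̃_w τ^{|w|}(x)` for every `x ∈ F` and every word `w`. -/
def IsRobust [T2Space X] (S : MultiSystem n X) (F : Set S.Tail) : Prop :=
  ∀ x ∈ F, ∀ w : List (Fin n), S.cover.wordMap w (S.shift^[w.length] x) ∈ F

/-- `F` is `τ`-invariant: `τ(F) ⊆ F`. -/
def IsShiftInvariant (S : MultiSystem n X) (F : Set S.Tail) : Prop :=
  ∀ x ∈ F, S.shift x ∈ F

/-! ### The tensor algebra and its C*-envelope -/

/-- Elements `∑ 𝔰_w f_w` (finite sums) of the covariance algebra `𝒜₀(X, σ)`. -/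
abbrev CovAlg (_S : MultiSystem n X) : Type u := List (Fin n) →₀ C₀(X, ℂ)

end MultiSystem

/-- The operator on the Hilbert space `H^m` given by an `m × m` matrix of operators on `H`;
its norm is the norm of the matrix in `𝔐_m(ℬ(H))`. -/
def blockOp {H : Type*} [NormedAddCommGroup H] [InnerProductSpace ℂ H] {m : ℕ}
    (M : Matrix (Fin m) (Fin m) (H →L[ℂ] H)) :
    PiLp 2 (fun _ : Fin m => H) →L[ℂ] PiLp 2 (fun _ : Fin m => H) :=
  (PiLp.continuousLinearEquiv 2 ℂ (fun _ : Fin m => H)).symm.toContinuousLinearMap ∘L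
    (ContinuousLinearMap.pi fun i => ∑ j, M i j ∘L ContinuousLinearMap.proj j) ∘L
    (PiLp.continuousLinearEquiv 2 ℂ (fun _ : Fin m => H)).toContinuousLinearMap

/-- A row contractive representation of the covariance algebra of `(X, σ)` on a Hilbert space:
a `*`-representation `π` of `C₀(X)` and operators `T i = ρ(𝔰_i)` satisfying the covariance relations
`f 𝔰_i = 𝔰_i (f ∘ σ_i)` and `‖[T₁ ⋯ T_n]‖ ≤ 1`.  -/
structure RowRep {n : ℕ} {X : Type u} [TopologicalSpace X] (S : MultiSystem n X)
    (H : Type u) [NormedAddCommGroup H] [InnerProductSpace ℂ H] [CompleteSpace H] where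
  π : C₀(X, ℂ) →⋆ₙₐ[ℂ] (H →L[ℂ] H)
  T : Fin n → (H →L[ℂ] H)
  covariant : ∀ i f, π f * T i = T i * π (S.pullback i f)
  row_contractive : ∀ h : Fin n → H, ‖∑ i, T i (h i)‖ ^ 2 ≤ ∑ i, ‖h i‖ ^ 2

namespace RowRep

variable {n : ℕ} {X : Type u} [TopologicalSpace X] {S : MultiSystem n X}
  {H : Type u} [NormedAddCommGroup H] [InnerProductSpace ℂ H] [CompleteSpace H]

/-- `ρ(𝔰_w) = ρ(𝔰_{i₁}) ⋯ ρ(𝔰_{i_k})` for `w = i₁ ⋯ i_k`. -/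
def word (ρ : RowRep S H) (w : List (Fin n)) : H →L[ℂ] H := (w.map ρ.T).prod

/-- `ρ(∑ 𝔰_w f_w) = ∑ ρ(𝔰_w) ρ(f_w)`. -/
def eval (ρ : RowRep S H) (a : S.CovAlg) : H →L[ℂ] H :=
  a.sum fun w f => ρ.word w * ρ.π f

/-- The image under `ρ` of a matrix over the covariance algebra. -/
def evalMatrix (ρ : RowRep S H) {m : ℕ} (a : Matrix (Fin m) (Fin m) S.CovAlg) :
    PiLp 2 (fun _ : Fin m => H) →L[ℂ] PiLp 2 (fun _ : Fin m => H) :=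
  blockOp fun i j => ρ.eval (a i j)

end RowRep

/-- The norm on `𝔐_m` of the tensor algebra `𝒜(X, σ)`, on matrices over the dense subalgebra
`𝒜₀(X, σ)`: the supremum over all row contractive representations. -/
def MultiSystem.tensorNorm {n : ℕ} {X : Type u} [TopologicalSpace X] (S : MultiSystem n X) {m : ℕ}
    (a : Matrix (Fin m) (Fin m) S.CovAlg) : ℝ :=
  sSup {r | ∃ (H : Type u) (_ : NormedAddCommGroup H) (_ : InnerProductSpace ℂ H)
    (_ : CompleteSpace H) (ρ : RowRep S H), r = ‖ρ.evalMatrix a‖}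

namespace RowRep

variable {n : ℕ} {X : Type u} [TopologicalSpace X] {S : MultiSystem n X}
  {H : Type u} [NormedAddCommGroup H] [InnerProductSpace ℂ H] [CompleteSpace H]

/-- `ρ` is a completely isometric representation of the tensor algebra. -/
def IsCompletelyIsometric (ρ : RowRep S H) : Prop :=
  ∀ (m : ℕ) (a : Matrix (Fin m) (Fin m) S.CovAlg), ‖ρ.evalMatrix a‖ = S.tensorNorm a

/-- The C*-algebra `C*(ρ(𝒜(X, σ)))`, i.e. the norm closed `*`-subalgebra generated by the range. -/
def cstar (ρ : RowRep S H) : NonUnitalStarSubalgebra ℂ (H →L[ℂ] H) :=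
  (NonUnitalStarAlgebra.adjoin ℂ (Set.range ρ.eval)).topologicalClosure

theorem eval_mem_cstar (ρ : RowRep S H) (a : S.CovAlg) : ρ.eval a ∈ ρ.cstar :=
  NonUnitalStarSubalgebra.le_topologicalClosure _
    (NonUnitalStarAlgebra.subset_adjoin ℂ _ (Set.mem_range_self a))

/-- `ρ.cstar` (with `ρ`) is the C*-envelope of the tensor algebra: `ρ` is completely isometric, and
for every completely isometric representation `ρ'` there is a surjective `*`-homomorphism
`q : C*(ρ'(𝒜)) → C*(ρ(𝒜))` with `q ρ' = ρ`. -/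
def IsCStarEnvelope (ρ : RowRep S H) : Prop :=
  ρ.IsCompletelyIsometric ∧
  ∀ (K : Type u) [NormedAddCommGroup K] [InnerProductSpace ℂ K] [CompleteSpace K]
    (ρ' : RowRep S K), ρ'.IsCompletelyIsometric →
    ∃ q : ρ'.cstar →⋆ₙₐ[ℂ] ρ.cstar, Function.Surjective q ∧
      ∀ a : S.CovAlg, q ⟨ρ'.eval a, ρ'.eval_mem_cstar a⟩ = ⟨ρ.eval a, ρ.eval_mem_cstar a⟩

/-! ### The algebra `𝔅`, the endomorphism `α` and ideals -/

/-- `𝔅`, the closed span of the elements `𝔱_u f 𝔱_v^*` with `|u| = |v|`. -/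
def coreAlg (ρ : RowRep S H) : Submodule ℂ (H →L[ℂ] H) :=
  (Submodule.span ℂ {b | ∃ (u v : List (Fin n)) (f : C₀(X, ℂ)), u.length = v.length ∧
    b = ρ.word u * ρ.π f * star (ρ.word v)}).topologicalClosure

/-- `α(b) = (1/n) ∑_{i,j} 𝔱_i b 𝔱_j^*`. -/
def endo (ρ : RowRep S H) (b : H →L[ℂ] H) : H →L[ℂ] H :=
  (n : ℂ)⁻¹ • ∑ i, ∑ j, ρ.T i * b * star (ρ.T j)

/-- `J` is an `α`-invariant (closed, two-sided) ideal of `𝔅`. -/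
structure IsInvariantIdeal (ρ : RowRep S H) (J : Submodule ℂ (H →L[ℂ] H)) : Prop where
  le : J ≤ ρ.coreAlg
  isClosed : IsClosed (J : Set (H →L[ℂ] H))
  mul_mem_left : ∀ b ∈ ρ.coreAlg, ∀ x ∈ J, b * x ∈ J
  mul_mem_right : ∀ b ∈ ρ.coreAlg, ∀ x ∈ J, x * b ∈ J
  endo_mem : ∀ x ∈ J, ρ.endo x ∈ J

/-- `J ∩ C₀(X)`, where `C₀(X)` sits in `𝔅` via `π`. -/
def interFun (ρ : RowRep S H) (J : Submodule ℂ (H →L[ℂ] H)) : Set C₀(X, ℂ) :=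
  {f | ρ.π f ∈ J}

end RowRep

/-- `I_F = {f ∈ C₀(Y) : f|F = 0}`. -/
def vanishingIdeal {Y : Type u} [TopologicalSpace Y] (F : Set Y) : Set C₀(Y, ℂ) :=
  {f | ∀ x ∈ F, f x = 0}

end

/-!
Every row contractive representation of the covering system is dominated by the regular
representation on `ℓ²(X̃ × ℤ)`, in which `𝔱_i` moves the basis vector of `(x, k)` to that of
`(σ̃_i x, k + 1)`: the Poisson kernel of `rρ`, `r < 1`, writes its matrix coefficients as limits of
those of the Fock representations along the orbits of the points of `X̃`, and `r → 1` recovers `ρ`.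
So the regular representation is completely isometric, and the C*-envelope is a quotient of the
C*-algebra it generates. In the regular representation the `𝔱_i` are isometries with orthogonal
ranges adding up to everything, because the sets `σ̃_i(X̃)` partition `X̃`; these relations pass to
the envelope.

By the Cuntz relations the span of the `𝔱_u f 𝔱_v^*` with `|u| = |v| = k` is the matrix algebra over
`C₀(X̃)` indexed by the words of length `k`, and these levels increase to a dense subalgebra of `𝔅`.
For an invariant ideal `𝔍` with `𝔍 ∩ C₀(X̃) = I_F`, the relation `𝔱_v^* (𝔱_v f 𝔱_u^*) 𝔱_u = f` makes
membership in `𝔍` at a point of `F` independent of the word by which the point was reached, so `F`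
is robust, while `α(𝔍) ⊆ 𝔍` makes `F` `τ`-invariant. Compressing to the corners of the matrix
levels shows that a matrix in level `k` within `ε` of `𝔍` has norm at most `ε` at every point of
`τ^k(F)`, and hence that `F` determines `𝔍`.
-/

noncomputable section

/-! ### Functions vanishing at infinity -/

section ZeroAtInfty

variable {Y : Type u} [TopologicalSpace Y]

theorem zeroAtInfty_sum_apply {ι E : Type*} [TopologicalSpace E] [AddCommMonoid E]
    [ContinuousAdd E] (t : Finset ι) (f : ι → C₀(Y, E)) (y : Y) :
    (∑ s ∈ t, f s) y = ∑ s ∈ t, f s y := by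
  induction t using Finset.cons_induction with
  | empty => simp
  | cons a t ha ih => simp [Finset.sum_cons, ih]

theorem zeroAtInfty_norm_le {E : Type*} [SeminormedAddCommGroup E] {f : C₀(Y, E)} {c : ℝ}
    (hc : 0 ≤ c) : ‖f‖ ≤ c ↔ ∀ y, ‖f y‖ ≤ c := by
  rw [← ZeroAtInftyContinuousMap.norm_toBCF_eq_norm]
  exact BoundedContinuousFunction.norm_le hc

theorem norm_zeroAtInfty_apply_le {E : Type*} [SeminormedAddCommGroup E] (f : C₀(Y, E)) (y : Y) :
    ‖f y‖ ≤ ‖f‖ :=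
  (zeroAtInfty_norm_le (norm_nonneg f)).1 le_rfl y

theorem exists_isCompact_norm_lt {E : Type*} [SeminormedAddCommGroup E] (f : C₀(Y, E)) {ε : ℝ}
    (hε : 0 < ε) : ∃ K, IsCompact K ∧ ∀ y ∉ K, ‖f y‖ < ε := by
  have hf : Filter.Tendsto (fun y => ‖f y‖) (Filter.cocompact Y) (nhds 0) := by
    simpa using (zero_at_infty f).norm
  obtain ⟨K, hK, hKs⟩ := Filter.mem_cocompact.1 (hf.eventually_lt_const hε)
  exact ⟨K, hK, fun y hy => hKs hy⟩

/-- The product of a function vanishing at infinity and a bounded continuous function. -/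
def mulBounded {A : Type*} [NonUnitalSeminormedRing A] (f : C₀(Y, A))
    (φ : BoundedContinuousFunction Y A) : C₀(Y, A) where
  toFun y := f y * φ y
  continuous_toFun := by fun_prop
  zero_at_infty' := by
    refine squeeze_zero_norm (a := fun y => ‖f y‖ * ‖φ‖) (fun y => ?_) ?_
    · exact (norm_mul_le _ _).trans (by gcongr; exact φ.norm_coe_le_norm y)
    · simpa using (zero_at_infty f).norm.mul_const ‖φ‖

theorem mulBounded_apply {A : Type*} [NonUnitalSeminormedRing A] (f : C₀(Y, A))
    (φ : BoundedContinuousFunction Y A) (y : Y) : mulBounded f φ y = f y * φ y := rfl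

/-- The witness is `g = f / (η + G)` for small `η > 0`, so that `f - g * G = f * η / (η + G)`. -/
theorem exists_norm_sub_mul_le {f G : C₀(Y, ℂ)} (hG : ∀ y, (‖G y‖ : ℂ) = G y) {δ ε : ℝ}
    (hδ : 0 < δ) (hε : 0 < ε) (hfG : ∀ y, ε ≤ ‖f y‖ → δ ≤ ‖G y‖) :
    ∃ g : C₀(Y, ℂ), ‖f - g * G‖ ≤ ε := by
  obtain ⟨η, hη, hηf⟩ := exists_pos_mul_lt (mul_pos hε hδ) ‖f‖
  have hden (y : Y) : 0 < η + ‖G y‖ := by positivity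
  let φ : BoundedContinuousFunction Y ℂ :=
    .ofNormedAddCommGroup (fun y => ((1 / (η + ‖G y‖) : ℝ) : ℂ))
      (Complex.continuous_ofReal.comp (continuous_const.div (by fun_prop) fun y => (hden y).ne'))
      (1 / η) fun y => by
        rw [Complex.norm_real, Real.norm_of_nonneg (one_div_nonneg.2 (hden y).le)]
        exact one_div_le_one_div_of_le hη (by simp)
  refine ⟨mulBounded f φ, (zeroAtInfty_norm_le hε.le).2 fun y => ?_⟩
  have hφ : (f - mulBounded f φ * G) y = f y * ((η / (η + ‖G y‖) : ℝ) : ℂ) := by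
    have h : ((η + ‖G y‖ : ℝ) : ℂ) ≠ 0 := Complex.ofReal_ne_zero.2 (hden y).ne'
    change f y - f y * ((1 / (η + ‖G y‖) : ℝ) : ℂ) * G y = _
    have hGy := hG y
    push_cast at h ⊢
    field_simp
    linear_combination f y * hGy
  rw [hφ, norm_mul, Complex.norm_real, Real.norm_of_nonneg (by positivity), ← mul_div_assoc,
    div_le_iff₀ (hden y)]
  by_cases hy : ε ≤ ‖f y‖
  · calc ‖f y‖ * η ≤ ‖f‖ * η := by gcongr; exact norm_zeroAtInfty_apply_le f y
      _ ≤ ε * δ := hηf.le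
      _ ≤ ε * (η + ‖G y‖) := by gcongr; linarith [hfG y hy]
  · gcongr
    · exact (not_le.1 hy).le
    · simp

theorem exists_mem_ideal_pos_on_isCompact {I : Submodule ℂ C₀(Y, ℂ)}
    (hI : ∀ g, ∀ f ∈ I, g * f ∈ I) {K : Set Y} (hK : IsCompact K)
    (hKI : ∀ y ∈ K, ∃ g ∈ I, g y ≠ 0) :
    ∃ G ∈ I, (∀ y, (‖G y‖ : ℂ) = G y) ∧ ∃ δ : ℝ, 0 < δ ∧ ∀ y ∈ K, δ ≤ ‖G y‖ := by
  choose! g hgI hg using hKI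
  obtain ⟨t, htK, ht⟩ := hK.elim_nhds_subcover (fun y => {z | g y z ≠ 0}) fun y hy =>
    (isOpen_ne_fun (map_continuous (g y)) continuous_const).mem_nhds (hg y hy)
  let G : C₀(Y, ℂ) := ∑ y ∈ t, star (g y) * g y
  have hG (z : Y) : G z = ((∑ y ∈ t, ‖g y z‖ ^ 2 : ℝ) : ℂ) := by
    simp [G, zeroAtInfty_sum_apply, Complex.conj_mul']
  have hGnorm (z : Y) : ‖G z‖ = ∑ y ∈ t, ‖g y z‖ ^ 2 := by
    rw [hG, Complex.norm_real, Real.norm_of_nonneg (by positivity)]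
  have hpos (z : Y) (hz : z ∈ K) : 0 < ‖G z‖ := by
    obtain ⟨y, hy, hyz⟩ := Set.mem_iUnion₂.1 (ht hz)
    rw [hGnorm]
    exact Finset.sum_pos' (fun y _ => by positivity)
      ⟨y, hy, pow_pos (norm_pos_iff.2 hyz) 2⟩
  exact ⟨G, I.sum_mem fun y hy => hI _ _ (hgI y (htK y hy)), fun y => by rw [hGnorm, hG],
    hK.exists_forall_le' (map_continuous G).norm.continuousOn hpos⟩

theorem closedIdeal_eq_vanishingIdeal {I : Submodule ℂ C₀(Y, ℂ)}
    (hI : ∀ g, ∀ f ∈ I, g * f ∈ I) (hcl : IsClosed (I : Set C₀(Y, ℂ))) :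
    (I : Set C₀(Y, ℂ)) = vanishingIdeal {y | ∀ f ∈ I, f y = 0} := by
  refine Set.Subset.antisymm (fun f hf y hy => hy f hf) fun f hf => ?_
  rw [← hcl.closure_eq]
  refine Metric.mem_closure_iff.2 fun ε hε => ?_
  obtain ⟨K, hK, hKf⟩ := exists_isCompact_norm_lt f (half_pos hε)
  have hne (y : Y) (hy : y ∈ K ∩ {y | ε / 2 ≤ ‖f y‖}) : ∃ g ∈ I, g y ≠ 0 := by
    by_contra! hcon
    exact ((half_pos hε).trans_le hy.2).ne' (by rw [hf y hcon, norm_zero])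
  obtain ⟨G, hGI, hG, δ, hδ, hδG⟩ := exists_mem_ideal_pos_on_isCompact hI
    (hK.inter_right (isClosed_le continuous_const (map_continuous f).norm)) hne
  obtain ⟨g, hg⟩ := exists_norm_sub_mul_le hG hδ (half_pos hε) fun y hy =>
    hδG y ⟨by_contra fun hyK => hy.not_gt (hKf y hyK), hy⟩
  refine ⟨g * G, hI g G hGI, ?_⟩
  rw [dist_eq_norm]
  exact hg.trans_lt (half_lt_self hε)

variable [T2Space Y] [LocallyCompactSpace Y]

theorem exists_zeroAtInfty_one_zero_of_isCompact {K t : Set Y} (hK : IsCompact K)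
    (ht : IsClosed t) (hKt : Disjoint K t) :
    ∃ e : C₀(Y, ℂ), Set.EqOn e 1 K ∧ Set.EqOn e 0 t ∧ ‖e‖ ≤ 1 ∧ ∀ y, ‖1 - e y‖ ≤ 1 := by
  obtain ⟨φ, h1, h0, hφ, h01⟩ := exists_continuous_one_zero_of_isCompact hK ht hKt
  let e : C₀(Y, ℂ) := ⟨⟨fun y => (φ y : ℂ), by fun_prop⟩, by
    simpa using! (Complex.continuous_ofReal.tendsto 0).comp hφ.is_zero_at_infty⟩
  have he (y : Y) : e y = φ y := rfl
  refine ⟨e, fun y hy => by simp [he, h1 hy], fun y hy => by simp [he, h0 hy],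
    (zeroAtInfty_norm_le zero_le_one).2 fun y => ?_, fun y => ?_⟩
  · rw [he, Complex.norm_real, Real.norm_of_nonneg (h01 y).1]
    exact (h01 y).2
  · rw [he, ← Complex.ofReal_one, ← Complex.ofReal_sub, Complex.norm_real,
      Real.norm_of_nonneg (sub_nonneg.2 (h01 y).2)]
    linarith [(h01 y).1]

theorem exists_zeroAtInfty_apply_eq_one {t : Set Y} (ht : IsClosed t) {y : Y} (hy : y ∉ t) :
    ∃ e : C₀(Y, ℂ), e y = 1 ∧ Set.EqOn e 0 t ∧ ‖e‖ ≤ 1 := by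
  obtain ⟨e, h1, h0, he, -⟩ := exists_zeroAtInfty_one_zero_of_isCompact
    (isCompact_singleton (x := y)) ht (Set.disjoint_singleton_left.2 hy)
  exact ⟨e, h1 rfl, h0, he⟩

theorem exists_norm_sub_mul_self_le (f : C₀(Y, ℂ)) {ε : ℝ} (hε : 0 < ε) :
    ∃ e : C₀(Y, ℂ), ‖f - f * e‖ ≤ ε := by
  obtain ⟨K, hK, hKf⟩ := exists_isCompact_norm_lt f hε
  obtain ⟨e, h1, -, -, he⟩ := exists_zeroAtInfty_one_zero_of_isCompact hK isClosed_empty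
    (Set.disjoint_empty K)
  refine ⟨e, (zeroAtInfty_norm_le hε.le).2 fun y => ?_⟩
  have hfe : (f - f * e) y = f y * (1 - e y) := by simp [mul_sub]
  by_cases hy : y ∈ K
  · simp [hfe, h1 hy, hε.le]
  · calc ‖(f - f * e) y‖ = ‖f y‖ * ‖1 - e y‖ := by rw [hfe, norm_mul]
      _ ≤ ‖f y‖ := mul_le_of_le_one_right (norm_nonneg _) (he y)
      _ ≤ ε := (hKf y hy).le

theorem subset_of_vanishingIdeal_subset {F F' : Set Y} (hF : IsClosed F)
    (h : vanishingIdeal F ⊆ vanishingIdeal F') : F' ⊆ F := by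
  intro y hy
  by_contra hyF
  obtain ⟨e, h1, h0, -⟩ := exists_zeroAtInfty_apply_eq_one hF hyF
  exact one_ne_zero (h1.symm.trans (h h0 y hy))

theorem vanishingIdeal_injOn_isClosed : Set.InjOn (vanishingIdeal (Y := Y)) {F | IsClosed F} :=
  fun _ hF _ hF' h => (subset_of_vanishingIdeal_subset hF' h.ge).antisymm
    (subset_of_vanishingIdeal_subset hF h.le)

end ZeroAtInfty

/-! ### Operator matrices -/

section OperatorMatrix

open scoped Matrix.Norms.L2Operator

variable {ι H : Type*} [Fintype ι] [NormedAddCommGroup H] [InnerProductSpace ℂ H] [CompleteSpace H]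
  {Y : Type*} [TopologicalSpace Y]

variable (ι H) in
/-- The operator on the Hilbert space `H^ι` given by a matrix of operators on `H`, as a
`*`-homomorphism in the matrix. It extends `blockOp` to an arbitrary finite index type. -/
def matOp : Matrix ι ι (H →L[ℂ] H) →⋆ₙₐ[ℂ]
    (PiLp 2 (fun _ : ι => H) →L[ℂ] PiLp 2 (fun _ : ι => H)) where
  toFun M := (PiLp.continuousLinearEquiv 2 ℂ (fun _ : ι => H)).symm.toContinuousLinearMap ∘L
    (ContinuousLinearMap.pi fun i => ∑ j, M i j ∘L ContinuousLinearMap.proj j) ∘L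
    (PiLp.continuousLinearEquiv 2 ℂ (fun _ : ι => H)).toContinuousLinearMap
  map_smul' c M := by
    ext x i
    simp [Finset.smul_sum]
  map_zero' := by
    ext x i
    simp
  map_add' M N := by
    ext x i
    simp [Finset.sum_add_distrib]
  map_mul' M N := by
    ext x i
    simpa [Matrix.mul_apply] using Finset.sum_comm
  map_star' M := by
    rw [ContinuousLinearMap.star_eq_adjoint, ContinuousLinearMap.eq_adjoint_iff]
    intro x y
    simpa [PiLp.inner_apply, sum_inner, inner_sum, ContinuousLinearMap.star_eq_adjoint,
      ContinuousLinearMap.adjoint_inner_left] using Finset.sum_comm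

theorem matOp_apply (M : Matrix ι ι (H →L[ℂ] H)) (x : PiLp 2 (fun _ : ι => H)) (p : ι) :
    matOp ι H M x p = ∑ q, M p q (x q) := by
  simp [matOp]

theorem inner_matOp (M : Matrix ι ι (H →L[ℂ] H)) (x y : PiLp 2 (fun _ : ι => H)) :
    inner ℂ y (matOp ι H M x) = ∑ p, ∑ q, inner ℂ (y p) (M p q (x q)) := by
  simp [PiLp.inner_apply, matOp_apply, inner_sum]

/-- The entries of a matrix-valued function vanishing at infinity: one half of the identification
`C₀(Y, M_ι) = M_ι(C₀(Y))`. -/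
def matrixEntries : C₀(Y, Matrix ι ι ℂ) →⋆ₙₐ[ℂ] Matrix ι ι C₀(Y, ℂ) where
  toFun G := .of fun p q =>
    { toFun := fun y => G y p q
      continuous_toFun := (map_continuous G).matrix_elem p q
      zero_at_infty' :=
        ((continuous_id.matrix_elem p q).tendsto (0 : Matrix ι ι ℂ)).comp (zero_at_infty G) }
  map_smul' c G := rfl
  map_zero' := rfl
  map_add' G G' := rfl
  map_mul' G G' := by
    ext p q y
    simp only [Matrix.mul_apply, zeroAtInfty_sum_apply]
    rfl
  map_star' G := rfl

variable (ι) in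
/-- The entrywise application of a `*`-homomorphism to square matrices, as a `*`-homomorphism. -/
def mapMatrixStarHom {A B : Type*} [NonUnitalSemiring A] [Module ℂ A] [StarRing A]
    [NonUnitalSemiring B] [Module ℂ B] [StarRing B] (φ : A →⋆ₙₐ[ℂ] B) :
    Matrix ι ι A →⋆ₙₐ[ℂ] Matrix ι ι B where
  toFun M := M.map φ
  map_smul' c M := by ext; simp
  map_zero' := by ext; simp
  map_add' M N := by ext; simp
  map_mul' M N := by ext; simp [Matrix.mul_apply]
  map_star' M := by ext; exact map_star φ _

theorem exists_matrixEntries_eq (g : Matrix ι ι C₀(Y, ℂ)) :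
    ∃ G : C₀(Y, Matrix ι ι ℂ), matrixEntries G = g ∧ ∀ y, G y = g.map fun f => f y := by
  refine ⟨⟨⟨fun y => g.map fun f => f y, ?_⟩, ?_⟩, rfl, fun y => rfl⟩
  · exact continuous_matrix fun p q => map_continuous (g p q)
  · exact tendsto_pi_nhds.2 fun p => tendsto_pi_nhds.2 fun q => zero_at_infty (g p q)

theorem norm_matOp_map_le [DecidableEq ι] {Y : Type u} [TopologicalSpace Y]
    (π : C₀(Y, ℂ) →⋆ₙₐ[ℂ] (H →L[ℂ] H))
    (g : Matrix ι ι C₀(Y, ℂ)) {c : ℝ} (hc : 0 ≤ c) (hg : ∀ y, ‖g.map fun f => f y‖ ≤ c) :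
    ‖matOp ι H (g.map π)‖ ≤ c := by
  obtain ⟨G, rfl, hG⟩ := exists_matrixEntries_eq g
  let Φ : C₀(Y, Matrix ι ι ℂ) →⋆ₙₐ[ℂ] _ :=
    (matOp ι H).comp ((mapMatrixStarHom ι π).comp matrixEntries)
  calc ‖Φ G‖ ≤ ‖G‖ := NonUnitalStarAlgHom.norm_apply_le Φ G
    _ ≤ c := (zeroAtInfty_norm_le hc).2 fun y => (hG y).symm ▸ hg y

theorem inner_apply_eq_inner_star (A : H →L[ℂ] H) (x z : H) :
    inner ℂ z (A x) = inner ℂ (star A z) x := by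
  rw [ContinuousLinearMap.star_eq_adjoint, ContinuousLinearMap.adjoint_inner_left]

theorem opNorm_le_of_norm_inner_le {E : Type*} [NormedAddCommGroup E] [InnerProductSpace ℂ E]
    {A : E →L[ℂ] E} {c : ℝ} (hc : 0 ≤ c) (h : ∀ x y, ‖inner ℂ y (A x)‖ ≤ c * ‖x‖ * ‖y‖) :
    ‖A‖ ≤ c := by
  refine ContinuousLinearMap.opNorm_le_of_re_inner_le hc fun x y hx hy => ?_
  calc RCLike.re (inner ℂ (A x) y) ≤ ‖inner ℂ (A x) y‖ := RCLike.re_le_norm _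
    _ ≤ c := by simpa [norm_inner_symm, hx, hy] using h x y

end OperatorMatrix

/-! ### The topology and dynamics of the covering system -/

namespace MultiSystem

variable {n : ℕ} {X : Type u} [TopologicalSpace X]

/-- `f ∘ σ_w` as an element of `C₀(X)`. -/
def pullWord (S : MultiSystem n X) : List (Fin n) → C₀(X, ℂ) → C₀(X, ℂ)
  | [], f => f
  | i :: w, f => pullWord S w (S.pullback i f)

theorem pullback_apply (S : MultiSystem n X) (i : Fin n) (f : C₀(X, ℂ)) (x : X) :
    S.pullback i f x = f (S.map i x) := rfl

theorem pullWord_apply (S : MultiSystem n X) (w : List (Fin n)) (f : C₀(X, ℂ)) (x : X) :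
    S.pullWord w f x = f (S.wordMap w x) := by
  induction w generalizing f with
  | nil => rfl
  | cons i w ih => rw [pullWord, ih]; rfl

theorem wordMap_cons (S : MultiSystem n X) (i : Fin n) (w : List (Fin n)) (x : X) :
    S.wordMap (i :: w) x = S.map i (S.wordMap w x) := rfl

theorem wordMap_append (S : MultiSystem n X) (w v : List (Fin n)) (x : X) :
    S.wordMap (w ++ v) x = S.wordMap w (S.wordMap v x) := by
  simp [wordMap]

variable (S : MultiSystem n X)

/-- The set of points that some `σ_w` with `|w| = k` maps into `K`; it confines the `k`-th
coordinate of a tail whose zeroth coordinate lies in `K`. -/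
def preimages (K : Set X) : ℕ → Set X
  | 0 => K
  | k + 1 => ⋃ i, S.map i ⁻¹' preimages K k

theorem isCompact_preimages {K : Set X} (hK : IsCompact K) (k : ℕ) :
    IsCompact (S.preimages K k) := by
  induction k with
  | zero => exact hK
  | succ k ih => exact isCompact_iUnion fun i => (S.isProper i).isCompact_preimage ih

theorem tailMap_eq_iff (i : Fin n) (y z : S.Tail) :
    S.tailMap i y = z ↔ z.1.1 0 = i ∧ y = S.shift z := by
  constructor
  · rintro rfl
    exact ⟨rfl, rfl⟩
  · rintro ⟨rfl, rfl⟩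
    exact S.tailMap_shift z

theorem tendsto_shift_cocompact :
    Filter.Tendsto S.shift (Filter.cocompact S.Tail) (Filter.cocompact S.Tail) := by
  intro s hs
  obtain ⟨K, hK, hKs⟩ := Filter.mem_cocompact.1 hs
  refine Filter.mem_cocompact.2 ⟨⋃ i, S.tailMap i '' K,
    isCompact_iUnion fun i => hK.image (S.continuous_tailMap i), ?_⟩
  intro z hz
  refine hKs fun hzK => hz (Set.mem_iUnion.2 ⟨z.1.1 0, S.shift z, hzK, S.tailMap_shift z⟩)

/-- The first `k` indices of a tail. -/
def initialWord : ℕ → S.Tail → List (Fin n)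
  | 0, _ => []
  | k + 1, z => z.1.1 0 :: initialWord k (S.shift z)

theorem length_initialWord (k : ℕ) (z : S.Tail) : (S.initialWord k z).length = k := by
  induction k generalizing z with
  | zero => rfl
  | succ k ih => simp [initialWord, ih]

/-- `f ∘ τ` as an element of `C₀(X̃)`. -/
def shiftPull (f : C₀(S.Tail, ℂ)) : C₀(S.Tail, ℂ) :=
  f.comp { toFun := S.shift
           continuous_toFun := S.continuous_shift
           cocompact_tendsto' := S.tendsto_shift_cocompact }

/-- The function which is `f ∘ τ` on the range of `σ̃_i` and zero elsewhere. -/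
def push (i : Fin n) (f : C₀(S.Tail, ℂ)) : C₀(S.Tail, ℂ) :=
  mulBounded (S.shiftPull f) <|
    .ofNormedAddCommGroup (fun z => if z.1.1 0 = i then 1 else 0)
      ((continuous_of_discreteTopology (f := fun j : Fin n => if j = i then (1 : ℂ) else 0)).comp
        (by fun_prop : Continuous fun z : S.Tail => z.1.1 0)) 1
      fun z => by split_ifs <;> simp

theorem push_apply (i : Fin n) (f : C₀(S.Tail, ℂ)) (z : S.Tail) :
    S.push i f z = if z.1.1 0 = i then f (S.shift z) else 0 := by
  change f (S.shift z) * (if z.1.1 0 = i then 1 else 0) = _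
  rw [mul_ite, mul_one, mul_zero]

/-- The function which is `f ∘ τ^{|w|}` on the range of `σ̃_w` and zero elsewhere. -/
def pushWord : List (Fin n) → C₀(S.Tail, ℂ) → C₀(S.Tail, ℂ)
  | [], f => f
  | i :: w, f => S.push i (pushWord w f)

theorem pushWord_apply_eq_or (w : List (Fin n)) (f : C₀(S.Tail, ℂ)) (z : S.Tail) :
    S.pushWord w f z = f (S.shift^[w.length] z) ∨ S.pushWord w f z = 0 := by
  induction w generalizing z with
  | nil => exact Or.inl rfl
  | cons i w ih =>
    rw [pushWord, push_apply]
    split_ifs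
    · exact ih _
    · exact Or.inr rfl

variable [T2Space X]

theorem isClosed_setOf_tail : IsClosed {z : (ℕ → Fin n) × (ℕ → X) |
    ∀ k, S.map (z.1 k) (z.2 (k + 1)) = z.2 k} := by
  have hc : Continuous fun p : Fin n × X => S.map p.1 p.2 :=
    continuous_prod_of_discrete_left.2 fun i => (S.isProper i).continuous
  rw [Set.ofPred_forall]
  refine isClosed_iInter fun k => isClosed_eq ?_ (by fun_prop)
  exact hc.comp (f := fun z : (ℕ → Fin n) × (ℕ → X) => (z.1 k, z.2 (k + 1))) (by fun_prop)

theorem isCompact_tail_zero_preimage {K : Set X} (hK : IsCompact K) :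
    IsCompact {z : S.Tail | z.1.2 0 ∈ K} := by
  have hC : IsCompact ((Set.univ : Set (ℕ → Fin n)) ×ˢ Set.univ.pi (S.preimages K)) :=
    isCompact_univ.prod (isCompact_univ_pi fun k => S.isCompact_preimages hK k)
  refine (S.isClosed_setOf_tail.isClosedEmbedding_subtypeVal.isCompact_preimage
    hC).of_isClosed_subset (hK.isClosed.preimage (by fun_prop)) fun z hz => ?_
  refine ⟨trivial, fun k _ => ?_⟩
  induction k with
  | zero => exact hz
  | succ k ih =>
    refine Set.mem_iUnion.2 ⟨z.1.1 k, ?_⟩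
    change S.map (z.1.1 k) (z.1.2 (k + 1)) ∈ S.preimages K k
    rw [z.2 k]
    exact ih trivial

instance [LocallyCompactSpace X] : LocallyCompactSpace S.Tail :=
  have : WeaklyLocallyCompactSpace S.Tail := ⟨fun z => by
    obtain ⟨K, hK, hKz⟩ := exists_compact_mem_nhds (z.1.2 0)
    refine ⟨_, S.isCompact_tail_zero_preimage hK, ?_⟩
    have hc : Continuous fun z : S.Tail => z.1.2 0 := by fun_prop
    exact hc.continuousAt.preimage_mem_nhds hKz⟩
  inferInstance

theorem pullback_shiftPull (i : Fin n) (f : C₀(S.Tail, ℂ)) :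
    S.cover.pullback i (S.shiftPull f) = f := rfl

theorem pullback_push (i j : Fin n) (f : C₀(S.Tail, ℂ)) :
    S.cover.pullback j (S.push i f) = if j = i then f else 0 := by
  ext z
  rw [pullback_apply, push_apply]
  change (if j = i then f z else 0) = _
  split_ifs <;> rfl

theorem pushWord_apply_wordMap (w : List (Fin n)) (f : C₀(S.Tail, ℂ)) (z : S.Tail) :
    S.pushWord w f (S.cover.wordMap w z) = f z := by
  induction w with
  | nil => rfl
  | cons i w ih =>
    rw [pushWord, push_apply, wordMap_cons]
    exact (if_pos rfl).trans ih

theorem shift_iterate_wordMap (w : List (Fin n)) (z : S.Tail) :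
    S.shift^[w.length] (S.cover.wordMap w z) = z := by
  induction w with
  | nil => rfl
  | cons _ _ ih => exact ih

theorem wordMap_initialWord (k : ℕ) (z : S.Tail) :
    S.cover.wordMap (S.initialWord k z) (S.shift^[k] z) = z := by
  induction k generalizing z with
  | zero => rfl
  | succ k ih =>
    rw [initialWord, wordMap_cons, Function.iterate_succ_apply, ih]
    exact S.tailMap_shift z

theorem wordMap_inj_of_length_eq {w v : List (Fin n)} {z : S.Tail} (hl : w.length = v.length)
    (h : S.cover.wordMap w z = S.cover.wordMap v z) : w = v := by
  induction w generalizing v with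
  | nil => exact (List.length_eq_zero_iff.1 hl.symm).symm
  | cons i w ih =>
    cases v with
    | nil => simp at hl
    | cons j v =>
      rw [wordMap_cons, wordMap_cons] at h
      obtain ⟨hij, hwv⟩ := (S.tailMap_eq_iff i _ _).1 h
      exact congrArg₂ _ hij.symm (ih (by simpa using hl) hwv)

end MultiSystem

/-! ### Multiplication and composition operators on `ℓ²` -/

/-- The Hilbert space `ℓ²(Ω)`. -/
abbrev EllTwo (Ω : Type u) : Type u := lp (fun _ : Ω => ℂ) 2

namespace EllTwo

variable {Ω : Type u}

theorem memℓp_two_iff {f : Ω → ℂ} : Memℓp f 2 ↔ Summable fun ω => ‖f ω‖ ^ 2 := by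
  simp [memℓp_gen_iff (p := 2) (by norm_num)]

theorem summable_norm_sq (f : EllTwo Ω) : Summable fun ω => ‖f ω‖ ^ 2 :=
  memℓp_two_iff.1 (lp.memℓp f)

theorem norm_sq_eq_tsum (f : EllTwo Ω) : ‖f‖ ^ 2 = ∑' ω, ‖f ω‖ ^ 2 := by
  simpa using lp.norm_rpow_eq_tsum (p := 2) (by norm_num) f

/-- The operator of multiplication by a function `φ` which is bounded by `c`. -/
def mulOp (φ : Ω → ℂ) {c : ℝ} (hc : 0 ≤ c) (hφ : ∀ ω, ‖φ ω‖ ≤ c) : EllTwo Ω →L[ℂ] EllTwo Ω :=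
  have hle (f : EllTwo Ω) (ω : Ω) : ‖φ ω * f ω‖ ^ 2 ≤ c ^ 2 * ‖f ω‖ ^ 2 := by
    rw [norm_mul, mul_pow]
    gcongr
    exact hφ ω
  have hs (f : EllTwo Ω) : Summable fun ω => ‖φ ω * f ω‖ ^ 2 :=
    .of_nonneg_of_le (fun _ => by positivity) (hle f) ((summable_norm_sq f).mul_left _)
  LinearMap.mkContinuous
    { toFun := fun f => ⟨fun ω => φ ω * f ω, memℓp_two_iff.2 (hs f)⟩
      map_add' := fun f g => by ext ω; exact mul_add _ _ _
      map_smul' := fun a f => by ext ω; simp [mul_left_comm] } c fun f => by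
    refine le_of_sq_le_sq ?_ (by positivity)
    rw [mul_pow, norm_sq_eq_tsum, norm_sq_eq_tsum, ← tsum_mul_left]
    exact (hs f).tsum_le_tsum (hle f) ((summable_norm_sq f).mul_left _)

theorem mulOp_apply (φ : Ω → ℂ) {c : ℝ} (hc : 0 ≤ c) (hφ : ∀ ω, ‖φ ω‖ ≤ c) (f : EllTwo Ω) (ω : Ω) :
    mulOp φ hc hφ f ω = φ ω * f ω := rfl

/-- The operator `f ↦ f ∘ s` of composition with an injective map `s`. -/
def compOp (s : Ω → Ω) (hs : Function.Injective s) : EllTwo Ω →L[ℂ] EllTwo Ω :=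
  LinearMap.mkContinuous
    { toFun := fun f => ⟨f ∘ s, memℓp_two_iff.2 ((summable_norm_sq f).comp_injective hs)⟩
      map_add' := fun f g => by ext ω; rfl
      map_smul' := fun a f => by ext ω; simp } 1 fun f => by
    refine le_of_sq_le_sq ?_ (by positivity)
    rw [one_mul, norm_sq_eq_tsum, norm_sq_eq_tsum]
    exact tsum_comp_le_tsum_of_inj (summable_norm_sq f) (fun _ => by positivity) hs

theorem compOp_apply (s : Ω → Ω) (hs : Function.Injective s) (f : EllTwo Ω) (ω : Ω) :
    compOp s hs f ω = f (s ω) := rfl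

open Classical in
/-- The standard basis vector of `ℓ²(Ω)` at a point. -/
def basisVec (ω : Ω) : EllTwo Ω := lp.single 2 ω 1

open Classical in
theorem inner_basisVec (ω : Ω) (f : EllTwo Ω) : inner ℂ (basisVec ω) f = f ω := by
  simp [basisVec, lp.inner_single_left]

open Classical in
theorem basisVec_apply (ω ω' : Ω) : basisVec ω ω' = if ω' = ω then 1 else 0 := by
  rw [basisVec, lp.single_apply, Pi.single_apply]

theorem star_apply_eq_inner (A : EllTwo Ω →L[ℂ] EllTwo Ω) (f : EllTwo Ω) (ω : Ω) :
    star A f ω = inner ℂ (A (basisVec ω)) f := by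
  rw [← inner_basisVec, ContinuousLinearMap.star_eq_adjoint,
    ContinuousLinearMap.adjoint_inner_right]

theorem star_compOp_basisVec (s : Ω → Ω) (hs : Function.Injective s) (ω : Ω) :
    star (compOp s hs) (basisVec ω) = basisVec (s ω) := by
  refine ext_inner_right ℂ fun f => ?_
  rw [← inner_apply_eq_inner_star, inner_basisVec, inner_basisVec, compOp_apply]

theorem star_compOp_apply (s : Ω → Ω) (hs : Function.Injective s) (f : EllTwo Ω) (ω : Ω) :
    star (compOp s hs) f (s ω) = f ω := by
  have hbasis : compOp s hs (basisVec (s ω)) = basisVec ω := by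
    ext ω'
    by_cases h : ω' = ω <;> simp [compOp_apply, basisVec_apply, hs.eq_iff, h]
  rw [star_apply_eq_inner, hbasis, inner_basisVec]

theorem star_compOp_apply_of_notMem (s : Ω → Ω) (hs : Function.Injective s) (f : EllTwo Ω) {ω : Ω}
    (hω : ω ∉ Set.range s) : star (compOp s hs) f ω = 0 := by
  have hbasis : compOp s hs (basisVec ω) = 0 := by
    ext ω'
    rw [compOp_apply, basisVec_apply, if_neg fun h => hω ⟨ω', h⟩]
    rfl
  rw [star_apply_eq_inner, hbasis, inner_zero_left]

end EllTwo

/-! ### The regular representation of the covering system -/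

theorem norm_sum_sq_of_star_mul_eq {ι H : Type*} [Fintype ι] [DecidableEq ι]
    [NormedAddCommGroup H] [InnerProductSpace ℂ H] [CompleteSpace H] {T : ι → (H →L[ℂ] H)}
    (hT : ∀ i j, star (T i) * T j = if i = j then 1 else 0) (h : ι → H) :
    ‖∑ i, T i (h i)‖ ^ 2 = ∑ i, ‖h i‖ ^ 2 := by
  have hinner (i j : ι) : inner ℂ (T i (h i)) (T j (h j)) =
      if i = j then inner ℂ (h i) (h i) else 0 := by
    rw [← star_star (T i), ← inner_apply_eq_inner_star, ← mul_apply_eq_comp, hT]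
    split_ifs with hij
    · subst hij; rfl
    · simp
  have hsq : ((‖∑ i, T i (h i)‖ : ℂ)) ^ 2 = ∑ i, (‖h i‖ : ℂ) ^ 2 := by
    simp only [← Complex.coe_algebraMap, ← inner_self_eq_norm_sq_to_K, sum_inner, inner_sum,
      hinner, Finset.sum_ite_eq', Finset.mem_univ, if_true]
  exact_mod_cast hsq

namespace MultiSystem

variable {n : ℕ} {X : Type u} [TopologicalSpace X] (S : MultiSystem n X)

/-- The map `(x, k) ↦ (σ̃_i(x), k + 1)`; the `ℤ`-coordinate keeps track of word length. -/
def gradedMap (i : Fin n) (p : S.Tail × ℤ) : S.Tail × ℤ := (S.tailMap i p.1, p.2 + 1)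

theorem gradedMap_eq_iff (i : Fin n) (p q : S.Tail × ℤ) :
    S.gradedMap i p = q ↔ q.1.1.1 0 = i ∧ p = (S.shift q.1, q.2 - 1) := by
  rw [gradedMap, Prod.ext_iff, Prod.ext_iff, S.tailMap_eq_iff, and_assoc]
  simp only [eq_sub_iff_add_eq]

theorem gradedMap_injective (i : Fin n) : Function.Injective (S.gradedMap i) := fun p q h =>
  ((S.gradedMap_eq_iff i p _).1 h).2.trans ((S.gradedMap_eq_iff i q _).1 rfl).2.symm

/-- The representation of `C₀(X̃)` on `ℓ²(X̃ × ℤ)` by multiplication operators. -/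
def regularPi : C₀(S.Tail, ℂ) →⋆ₙₐ[ℂ] (EllTwo (S.Tail × ℤ) →L[ℂ] EllTwo (S.Tail × ℤ)) where
  toFun f := EllTwo.mulOp (fun p => f p.1) (norm_nonneg f) fun p => norm_zeroAtInfty_apply_le f p.1
  map_smul' c f := by
    ext h p
    exact mul_assoc _ _ _
  map_zero' := by
    ext h p
    exact zero_mul _
  map_add' f g := by
    ext h p
    exact add_mul _ _ _
  map_mul' f g := by
    ext h p
    exact mul_assoc _ _ _
  map_star' f := by
    refine ContinuousLinearMap.ext fun x => ext_inner_left ℂ fun y => ?_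
    rw [ContinuousLinearMap.star_eq_adjoint, ContinuousLinearMap.adjoint_inner_right,
      lp.inner_eq_tsum, lp.inner_eq_tsum]
    refine tsum_congr fun p => ?_
    simp only [EllTwo.mulOp_apply, ZeroAtInftyContinuousMap.star_apply, RCLike.inner_apply,
      map_mul, Complex.star_def]
    ring

theorem regularPi_apply (f : C₀(S.Tail, ℂ)) (h : EllTwo (S.Tail × ℤ)) (p : S.Tail × ℤ) :
    S.regularPi f h p = f p.1 * h p := rfl

theorem regularPi_basisVec (f : C₀(S.Tail, ℂ)) (p : S.Tail × ℤ) :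
    S.regularPi f (EllTwo.basisVec p) = f p.1 • EllTwo.basisVec p := by
  ext q
  rw [regularPi_apply, lp.coeFn_smul, Pi.smul_apply, EllTwo.basisVec_apply]
  split_ifs with h
  · rw [h]; rfl
  · simp

/-- The isometry of `ℓ²(X̃ × ℤ)` that maps the basis vector at `p` to the one at
`gradedMap i p`. -/
def regularT (i : Fin n) : EllTwo (S.Tail × ℤ) →L[ℂ] EllTwo (S.Tail × ℤ) :=
  star (EllTwo.compOp (S.gradedMap i) (S.gradedMap_injective i))

theorem regularT_apply (i : Fin n) (h : EllTwo (S.Tail × ℤ)) (p : S.Tail × ℤ) :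
    S.regularT i h p = if p.1.1.1 0 = i then h (S.shift p.1, p.2 - 1) else 0 := by
  split_ifs with hi
  · conv_lhs => rw [← (S.gradedMap_eq_iff i (S.shift p.1, p.2 - 1) p).2 ⟨hi, rfl⟩]
    exact EllTwo.star_compOp_apply _ _ _ _
  · refine EllTwo.star_compOp_apply_of_notMem _ _ _ ?_
    rintro ⟨q, hq⟩
    exact hi ((S.gradedMap_eq_iff i q p).1 hq).1

theorem star_regularT_apply (i : Fin n) (h : EllTwo (S.Tail × ℤ)) (p : S.Tail × ℤ) :
    star (S.regularT i) h p = h (S.tailMap i p.1, p.2 + 1) := by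
  rw [regularT, star_star]
  rfl

theorem regularT_basisVec (i : Fin n) (p : S.Tail × ℤ) :
    S.regularT i (EllTwo.basisVec p) = EllTwo.basisVec (S.tailMap i p.1, p.2 + 1) :=
  EllTwo.star_compOp_basisVec _ _ _

theorem star_regularT_mul_regularT (i j : Fin n) :
    star (S.regularT i) * S.regularT j = if i = j then 1 else 0 := by
  ext h p
  rw [mul_apply_eq_comp, star_regularT_apply, regularT_apply]
  change (if i = j then h (p.1, p.2 + 1 - 1) else 0) = _
  rw [add_sub_cancel_right]
  split_ifs <;> rfl

theorem sum_regularT_mul_star : ∑ i, S.regularT i * star (S.regularT i) = 1 := by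
  refine ContinuousLinearMap.ext fun h => ?_
  rw [sum_apply]
  ext p
  rw [lp.coeFn_sum, Finset.sum_apply, Finset.sum_eq_single (p.1.1.1 0)]
  · rw [mul_apply_eq_comp, regularT_apply, if_pos rfl, star_regularT_apply]
    simp only [S.tailMap_shift, sub_add_cancel]
    rfl
  · intro i _ hi
    rw [mul_apply_eq_comp, regularT_apply, if_neg hi.symm]
  · simp

variable [T2Space X]

/-- The regular representation of the covering system on `ℓ²(X̃ × ℤ)`. -/
def regularRep : RowRep S.cover (EllTwo (S.Tail × ℤ)) where
  π := S.regularPi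
  T := S.regularT
  covariant i f := by
    ext h p
    simp only [mul_apply_eq_comp, regularPi_apply, regularT_apply]
    split_ifs with hi
    · subst hi
      rw [pullback_apply]
      exact congrArg (f · * _) (S.tailMap_shift p.1).symm
    · rw [mul_zero]
  row_contractive h := (norm_sum_sq_of_star_mul_eq S.star_regularT_mul_regularT h).le

end MultiSystem

/-! ### Row contractive representations and their Poisson kernels -/

/-- The words of length `k` in `n` letters. -/
def words (n : ℕ) : ℕ → Finset (List (Fin n))
  | 0 => {[]}
  | k + 1 => (words n k ×ˢ Finset.univ).image fun p => p.1 ++ [p.2]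

theorem mem_words {n k : ℕ} {w : List (Fin n)} : w ∈ words n k ↔ w.length = k := by
  induction k generalizing w with
  | zero => simp [words, List.length_eq_zero_iff]
  | succ k ih =>
    simp only [words, Finset.mem_image, Finset.mem_product, ih, Finset.mem_univ, and_true]
    constructor
    · rintro ⟨p, hp, rfl⟩
      simp [hp]
    · intro hw
      rcases List.eq_nil_or_concat w with rfl | ⟨v, i, rfl⟩
      · simp at hw
      · exact ⟨(v, i), by simpa using hw, by simp⟩

theorem sum_words_succ {n : ℕ} {A : Type*} [AddCommMonoid A] (k : ℕ) (F : List (Fin n) → A) :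
    ∑ w ∈ words n (k + 1), F w = ∑ w ∈ words n k, ∑ i, F (w ++ [i]) := by
  rw [words, Finset.sum_image, Finset.sum_product]
  rintro ⟨v, i⟩ _ ⟨w, j⟩ _ h
  simpa [List.append_singleton_inj] using h

/-- The words of length less than `k` in `n` letters. -/
def wordsLT (n k : ℕ) : Finset (List (Fin n)) := (Finset.range k).biUnion (words n)

theorem mem_wordsLT {n k : ℕ} {w : List (Fin n)} : w ∈ wordsLT n k ↔ w.length < k := by
  simp [wordsLT, mem_words]

theorem sum_wordsLT {n : ℕ} {A : Type*} [AddCommMonoid A] (k : ℕ) (F : List (Fin n) → A) :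
    ∑ w ∈ wordsLT n k, F w = ∑ l ∈ Finset.range k, ∑ w ∈ words n l, F w := by
  refine Finset.sum_biUnion fun l _ l' _ hl => Finset.disjoint_left.2 fun w hw hw' => hl ?_
  rw [← mem_words.1 hw, ← mem_words.1 hw']

namespace RowRep

section General

variable {n : ℕ} {Y : Type u} [TopologicalSpace Y] {S : MultiSystem n Y}
  {H : Type u} [NormedAddCommGroup H] [InnerProductSpace ℂ H] [CompleteSpace H] (ρ : RowRep S H)

theorem word_nil : ρ.word [] = 1 := rfl

theorem word_cons (i : Fin n) (w : List (Fin n)) : ρ.word (i :: w) = ρ.T i * ρ.word w := by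
  simp [word]

theorem word_append (w v : List (Fin n)) : ρ.word (w ++ v) = ρ.word w * ρ.word v := by
  simp [word]

theorem word_singleton (i : Fin n) : ρ.word [i] = ρ.T i := by
  simp [word]

theorem π_mul_word (w : List (Fin n)) (f : C₀(Y, ℂ)) :
    ρ.π f * ρ.word w = ρ.word w * ρ.π (S.pullWord w f) := by
  induction w generalizing f with
  | nil => simp [word_nil, MultiSystem.pullWord]
  | cons i w ih => rw [word_cons, ← mul_assoc, ρ.covariant, mul_assoc, ih, mul_assoc]; rfl

theorem star_word_mul_π (w : List (Fin n)) (f : C₀(Y, ℂ)) :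
    star (ρ.word w) * ρ.π f = ρ.π (S.pullWord w f) * star (ρ.word w) := by
  have hpull : S.pullWord w (star f) = star (S.pullWord w f) := by
    ext y
    simp [MultiSystem.pullWord_apply]
  have h := congrArg star (ρ.π_mul_word w (star f))
  rwa [star_mul, star_mul, hpull, map_star, map_star, star_star, star_star] at h

/-- The operator `∑ T_i T_i^*`. -/
def rangeSum : H →L[ℂ] H := ∑ i, ρ.T i * star (ρ.T i)

theorem inner_rangeSum (x y : H) :
    inner ℂ y (ρ.rangeSum x) = ∑ i, inner ℂ (star (ρ.T i) y) (star (ρ.T i) x) := by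
  simp only [rangeSum, sum_apply, mul_apply_eq_comp, inner_sum, inner_apply_eq_inner_star]

theorem inner_rangeSum_self (x : H) :
    inner ℂ x (ρ.rangeSum x) = ((∑ i, ‖star (ρ.T i) x‖ ^ 2 : ℝ) : ℂ) := by
  rw [inner_rangeSum]
  push_cast
  exact Finset.sum_congr rfl fun i _ => inner_self_eq_norm_sq_to_K _

theorem sum_norm_star_T_sq_le (x : H) : ∑ i, ‖star (ρ.T i) x‖ ^ 2 ≤ ‖x‖ ^ 2 := by
  set s := ∑ i, ‖star (ρ.T i) x‖ ^ 2
  have hs : 0 ≤ s := by positivity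
  have hrow : ‖ρ.rangeSum x‖ ^ 2 ≤ s := by
    simpa [rangeSum, sum_apply] using ρ.row_contractive fun i => star (ρ.T i) x
  have hinner : s ≤ ‖x‖ * ‖ρ.rangeSum x‖ := by
    have h := norm_inner_le_norm (𝕜 := ℂ) x (ρ.rangeSum x)
    rwa [inner_rangeSum_self, Complex.norm_real, Real.norm_of_nonneg hs] at h
  have hsq : s * s ≤ ‖x‖ ^ 2 * s := by
    calc s * s ≤ (‖x‖ * ‖ρ.rangeSum x‖) * (‖x‖ * ‖ρ.rangeSum x‖) := by gcongr
      _ = ‖x‖ ^ 2 * ‖ρ.rangeSum x‖ ^ 2 := by ring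
      _ ≤ ‖x‖ ^ 2 * s := by gcongr
  rcases hs.eq_or_lt with h | h
  · rw [← h]
    positivity
  · exact le_of_mul_le_mul_right hsq h

theorem sum_norm_star_word_sq_le (k : ℕ) (x : H) :
    ∑ w ∈ words n k, ‖star (ρ.word w) x‖ ^ 2 ≤ ‖x‖ ^ 2 := by
  induction k with
  | zero => simp [words, word_nil]
  | succ k ih =>
    calc ∑ w ∈ words n (k + 1), ‖star (ρ.word w) x‖ ^ 2
        = ∑ w ∈ words n k, ∑ i, ‖star (ρ.T i) (star (ρ.word w) x)‖ ^ 2 := by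
          simp only [sum_words_succ, word_append, word_singleton, star_mul, mul_apply_eq_comp]
      _ ≤ ∑ w ∈ words n k, ‖star (ρ.word w) x‖ ^ 2 :=
          Finset.sum_le_sum fun w _ => ρ.sum_norm_star_T_sq_le _
      _ ≤ ‖x‖ ^ 2 := ih

theorem rangeSum_le_one : ρ.rangeSum ≤ 1 := by
  rw [← sub_nonneg, ContinuousLinearMap.nonneg_iff_isPositive,
    ContinuousLinearMap.isPositive_iff_complex]
  intro x
  have hinner : inner ℂ ((1 - ρ.rangeSum) x) x =
      ((‖x‖ ^ 2 - ∑ i, ‖star (ρ.T i) x‖ ^ 2 : ℝ) : ℂ) := by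
    rw [← inner_conj_symm, sub_apply, inner_sub_right, inner_rangeSum_self, one_apply_eq_self,
      inner_self_eq_norm_sq_to_K]
    simp
  rw [hinner]
  exact ⟨rfl, sub_nonneg.2 (ρ.sum_norm_star_T_sq_le x)⟩

theorem commute_rangeSum_π (f : C₀(Y, ℂ)) : Commute ρ.rangeSum (ρ.π f) := by
  refine Commute.sum_left _ _ _ fun i _ => ?_
  have hT := ρ.π_mul_word [i] f
  have hstar := ρ.star_word_mul_π [i] f
  rw [word_singleton] at hT hstar
  rw [commute_iff_eq, mul_assoc, hstar, ← mul_assoc, ← hT, mul_assoc]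

/-- The defect operator `(1 - ∑ T_i T_i^*)^{1/2}` of the row contraction. -/
def defect : H →L[ℂ] H := CFC.sqrt (1 - ρ.rangeSum)

theorem commute_defect_π (f : C₀(Y, ℂ)) : Commute ρ.defect (ρ.π f) := by
  rw [defect, CFC.sqrt_eq_cfc]
  exact ((Commute.one_left _).sub_left (ρ.commute_rangeSum_π f)).cfc_nnreal _

theorem inner_defect (x y : H) : inner ℂ (ρ.defect y) (ρ.defect x) =
    inner ℂ y x - ∑ i, inner ℂ (star (ρ.T i) y) (star (ρ.T i) x) := by
  have hstar : star ρ.defect = ρ.defect := (IsSelfAdjoint.of_nonneg (CFC.sqrt_nonneg _)).star_eq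
  have hsq : ρ.defect * ρ.defect = 1 - ρ.rangeSum :=
    CFC.sqrt_mul_sqrt_self _ (sub_nonneg.2 ρ.rangeSum_le_one)
  calc inner ℂ (ρ.defect y) (ρ.defect x) = inner ℂ y ((ρ.defect * ρ.defect) x) := by
        rw [mul_apply_eq_comp, inner_apply_eq_inner_star ρ.defect (ρ.defect x) y, hstar]
    _ = _ := by rw [hsq, sub_apply, inner_sub_right, inner_rangeSum, one_apply_eq_self]

/-- The coefficient at the word `v` of the Poisson kernel `H → ⨁_v H`, `x ↦ (D T_v^* x)_v`, where
`D` is the defect operator. -/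
def poisson (v : List (Fin n)) (x : H) : H := ρ.defect (star (ρ.word v) x)

theorem poisson_append (w v : List (Fin n)) (x : H) :
    ρ.poisson (w ++ v) x = ρ.poisson v (star (ρ.word w) x) := by
  simp only [poisson, word_append, star_mul, mul_apply_eq_comp]

theorem π_pullWord_poisson (v : List (Fin n)) (f : C₀(Y, ℂ)) (x : H) :
    ρ.π (S.pullWord v f) (ρ.poisson v x) = ρ.poisson v (ρ.π f x) := by
  rw [poisson, poisson, ← mul_apply_eq_comp, ← (ρ.commute_defect_π _).eq, mul_apply_eq_comp,
    ← mul_apply_eq_comp _ (star (ρ.word v)), ← star_word_mul_π, mul_apply_eq_comp]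

theorem sum_inner_poisson (N : ℕ) (x z : H) :
    ∑ v ∈ wordsLT n N, inner ℂ (ρ.poisson v z) (ρ.poisson v x) = inner ℂ z x -
      ∑ v ∈ words n N, inner ℂ (star (ρ.word v) z) (star (ρ.word v) x) := by
  rw [sum_wordsLT]
  induction N with
  | zero => simp [words, word_nil]
  | succ N ih =>
    rw [Finset.sum_range_succ, ih, sum_words_succ]
    simp only [poisson, inner_defect, Finset.sum_sub_distrib, word_append, word_singleton,
      star_mul, mul_apply_eq_comp]
    ring

theorem sum_norm_poisson_sq_le (N : ℕ) (x : H) :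
    ∑ v ∈ wordsLT n N, ‖ρ.poisson v x‖ ^ 2 ≤ ‖x‖ ^ 2 := by
  have hsum := ρ.sum_inner_poisson N x x
  simp only [inner_self_eq_norm_sq_to_K, Complex.coe_algebraMap] at hsum
  have hreal : ∑ v ∈ wordsLT n N, ‖ρ.poisson v x‖ ^ 2 =
      ‖x‖ ^ 2 - ∑ v ∈ words n N, ‖star (ρ.word v) x‖ ^ 2 := by
    exact_mod_cast hsum
  rw [hreal]
  exact sub_le_self _ (by positivity)

/-- A row contractive representation is pure if `∑_{|w| = N} T_w T_w^* → 0` strongly. -/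
def IsPure : Prop := ∀ x, Filter.Tendsto (fun N => ∑ w ∈ words n N, ‖star (ρ.word w) x‖ ^ 2)
  Filter.atTop (nhds 0)

variable {ρ} in
theorem IsPure.tendsto_sum_inner_poisson (hρ : ρ.IsPure) (x z : H) :
    Filter.Tendsto (fun N => ∑ v ∈ wordsLT n N, inner ℂ (ρ.poisson v z) (ρ.poisson v x))
      Filter.atTop (nhds (inner ℂ z x)) := by
  simp only [ρ.sum_inner_poisson]
  have htail : Filter.Tendsto (fun N => ∑ v ∈ words n N,
      inner ℂ (star (ρ.word v) z) (star (ρ.word v) x)) Filter.atTop (nhds 0) := by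
    refine squeeze_zero_norm (a := fun N => √(∑ v ∈ words n N, ‖star (ρ.word v) z‖ ^ 2) *
      √(∑ v ∈ words n N, ‖star (ρ.word v) x‖ ^ 2)) (fun N => ?_) ?_
    · calc _ ≤ ∑ v ∈ words n N, ‖inner ℂ (star (ρ.word v) z) (star (ρ.word v) x)‖ :=
            norm_sum_le _ _
        _ ≤ ∑ v ∈ words n N, ‖star (ρ.word v) z‖ * ‖star (ρ.word v) x‖ :=
            Finset.sum_le_sum fun v _ => norm_inner_le_norm _ _
        _ ≤ _ := Real.sum_mul_le_sqrt_mul_sqrt _ _ _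
    · simpa using (hρ z).sqrt.mul (hρ x).sqrt
  simpa using tendsto_const_nhds.sub htail

/-- The row contractive representation with the operators `c T_i`. -/
def scale {c : ℂ} (hc : ‖c‖ ≤ 1) : RowRep S H where
  π := ρ.π
  T i := c • ρ.T i
  covariant i f := by rw [mul_smul_comm, ρ.covariant, smul_mul_assoc]
  row_contractive h := by
    simp only [smul_apply, ← Finset.smul_sum, norm_smul, mul_pow]
    calc ‖c‖ ^ 2 * ‖∑ i, ρ.T i (h i)‖ ^ 2 ≤ 1 * ‖∑ i, ρ.T i (h i)‖ ^ 2 := by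
          gcongr
          exact pow_le_one₀ (norm_nonneg c) hc
      _ ≤ ∑ i, ‖h i‖ ^ 2 := (one_mul _).trans_le (ρ.row_contractive h)

theorem scale_word {c : ℂ} (hc : ‖c‖ ≤ 1) (w : List (Fin n)) :
    (ρ.scale hc).word w = c ^ w.length • ρ.word w := by
  induction w with
  | nil => simp [word_nil]
  | cons i w ih =>
    rw [word_cons, ih, word_cons, List.length_cons, pow_succ']
    exact smul_mul_smul_comm c (ρ.T i) (c ^ w.length) (ρ.word w)

theorem isPure_scale {c : ℂ} (hc : ‖c‖ < 1) : (ρ.scale hc.le).IsPure := by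
  intro x
  refine squeeze_zero (g := fun N => (‖c‖ ^ 2) ^ N * ‖x‖ ^ 2) (fun N => by positivity)
    (fun N => ?_) ?_
  · calc ∑ w ∈ words n N, ‖star ((ρ.scale hc.le).word w) x‖ ^ 2
        = ∑ w ∈ words n N, (‖c‖ ^ 2) ^ N * ‖star (ρ.word w) x‖ ^ 2 := by
          refine Finset.sum_congr rfl fun w hw => ?_
          rw [scale_word, star_smul, smul_apply, norm_smul, norm_star, norm_pow,
            mem_words.1 hw, mul_pow, pow_right_comm]
      _ ≤ (‖c‖ ^ 2) ^ N * ‖x‖ ^ 2 := by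
          rw [← Finset.mul_sum]
          gcongr
          exact ρ.sum_norm_star_word_sq_le N x
  · simpa using (tendsto_pow_atTop_nhds_zero_of_lt_one (by positivity)
      (pow_lt_one₀ (norm_nonneg c) hc two_ne_zero)).mul_const (‖x‖ ^ 2)

theorem inner_evalMatrix {m : ℕ} (a : Matrix (Fin m) (Fin m) S.CovAlg)
    (x z : PiLp 2 fun _ : Fin m => H) :
    inner ℂ z (ρ.evalMatrix a x) = ∑ i, ∑ j, inner ℂ (z i) (ρ.eval (a i j) (x j)) :=
  inner_matOp (fun i j => ρ.eval (a i j)) x z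

theorem inner_eval (a : S.CovAlg) (x z : H) :
    inner ℂ z (ρ.eval a x) = ∑ w ∈ a.support, inner ℂ (star (ρ.word w) z) (ρ.π (a w) x) := by
  simp only [eval, Finsupp.sum, sum_apply, mul_apply_eq_comp, inner_sum,
    inner_apply_eq_inner_star]

end General

end RowRep

/-! ### Domination by the regular representation -/

namespace MultiSystem

open scoped Matrix.Norms.L2Operator

variable {n : ℕ} {X : Type u} [TopologicalSpace X] [T2Space X] (S : MultiSystem n X)

theorem regularRep_word_basisVec (w : List (Fin n)) (p : S.Tail × ℤ) :
    S.regularRep.word w (EllTwo.basisVec p) =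
      EllTwo.basisVec (S.cover.wordMap w p.1, p.2 + w.length) := by
  induction w with
  | nil => simp [RowRep.word_nil, wordMap]
  | cons i w ih =>
    rw [RowRep.word_cons, mul_apply_eq_comp, ih]
    refine (S.regularT_basisVec i _).trans ?_
    rw [wordMap_cons, List.length_cons]
    congr 2
    push_cast
    ring

/-- The basis vector of `ℓ²(X̃ × ℤ)` at the point of the orbit of `y` reached along `v`. For fixed
`y` these vectors span a copy of the full Fock space. -/
def orbitVec (y : S.Tail) (v : List (Fin n)) : EllTwo (S.Tail × ℤ) :=
  EllTwo.basisVec (S.cover.wordMap v y, (v.length : ℤ))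

theorem orthonormal_orbitVec (y : S.Tail) : Orthonormal ℂ (S.orbitVec y) := by
  rw [orthonormal_iff_ite]
  intro u v
  rw [orbitVec, orbitVec, EllTwo.inner_basisVec, EllTwo.basisVec_apply]
  by_cases huv : u = v
  · simp [huv]
  · rw [if_neg huv, if_neg fun h => huv ?_]
    rw [Prod.ext_iff] at h
    exact S.wordMap_inj_of_length_eq (by simpa using h.2) h.1

theorem regularRep_eval_orbitVec (a : S.cover.CovAlg) (y : S.Tail) (v : List (Fin n)) :
    S.regularRep.eval a (S.orbitVec y v) =
      ∑ w ∈ a.support, S.cover.pullWord v (a w) y • S.orbitVec y (w ++ v) := by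
  rw [RowRep.eval, Finsupp.sum, sum_apply]
  refine Finset.sum_congr rfl fun w _ => ?_
  have hπ : S.regularRep.π (a w) (S.orbitVec y v) =
      a w (S.cover.wordMap v y) • S.orbitVec y v := S.regularPi_basisVec _ _
  rw [mul_apply_eq_comp, hπ, map_smul, pullWord_apply, orbitVec, regularRep_word_basisVec,
    orbitVec, wordMap_append, List.length_append, Nat.cast_add, add_comm (w.length : ℤ)]

/-- The `(u, v)` entry of `a` in the representation on the full Fock module over `C₀(X̃)`. -/
def fockEntry (a : S.cover.CovAlg) (u v : List (Fin n)) : C₀(S.Tail, ℂ) :=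
  ∑ w ∈ a.support, if u = w ++ v then S.cover.pullWord v (a w) else 0

theorem fockEntry_apply (a : S.cover.CovAlg) (u v : List (Fin n)) (y : S.Tail) :
    S.fockEntry a u v y = inner ℂ (S.orbitVec y u) (S.regularRep.eval a (S.orbitVec y v)) := by
  rw [fockEntry, regularRep_eval_orbitVec, zeroAtInfty_sum_apply, inner_sum]
  refine Finset.sum_congr rfl fun w _ => ?_
  rw [inner_smul_right, orthonormal_iff_ite.1 (S.orthonormal_orbitVec y)]
  split_ifs <;> simp

/-- The vector of `ℓ²(X̃ × ℤ)^m` with coordinates `η` with respect to the orbit of `y`. -/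
def orbitSum {m : ℕ} {E : Finset (List (Fin n))} (y : S.Tail)
    (η : EuclideanSpace ℂ (Fin m × E)) : PiLp 2 fun _ : Fin m => EllTwo (S.Tail × ℤ) :=
  WithLp.toLp 2 fun j => ∑ v : E, η (j, v) • S.orbitVec y v

theorem norm_orbitSum {m : ℕ} {E : Finset (List (Fin n))} (y : S.Tail)
    (η : EuclideanSpace ℂ (Fin m × E)) : ‖S.orbitSum y η‖ = ‖η‖ := by
  rw [PiLp.norm_eq_of_L2, EuclideanSpace.norm_eq, Fintype.sum_prod_type]
  congr 1
  refine Finset.sum_congr rfl fun j _ => ?_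
  have hsq := ((S.orthonormal_orbitVec y).comp _ Subtype.val_injective).inner_sum
    (fun v : E => η (j, v)) (fun v => η (j, v)) Finset.univ
  simp only [Function.comp_apply, inner_self_eq_norm_sq_to_K, Complex.conj_mul',
    Complex.coe_algebraMap] at hsq
  exact_mod_cast hsq

theorem inner_orbitSum_evalMatrix {m : ℕ} (a : Matrix (Fin m) (Fin m) S.cover.CovAlg)
    {E : Finset (List (Fin n))} (y : S.Tail) (η ξ : EuclideanSpace ℂ (Fin m × E)) :
    inner ℂ (S.orbitSum y ξ) (S.regularRep.evalMatrix a (S.orbitSum y η)) =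
      inner ℂ ξ (Matrix.toEuclideanCLM (𝕜 := ℂ)
        (Matrix.of fun p q : Fin m × E => S.fockEntry (a p.1 q.1) p.2 q.2 y) η) := by
  rw [RowRep.inner_evalMatrix, PiLp.inner_apply, Fintype.sum_prod_type]
  refine Finset.sum_congr rfl fun i _ => ?_
  simp only [orbitSum, map_sum, map_smul, sum_inner, inner_sum, inner_smul_left,
    inner_smul_right, Matrix.ofLp_toEuclideanCLM, Matrix.mulVec, dotProduct, Matrix.of_apply,
    Fintype.sum_prod_type, fockEntry_apply, RCLike.inner_apply, Finset.sum_mul, Finset.mul_sum]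
  conv_rhs => rw [Finset.sum_comm]
  refine Finset.sum_congr rfl fun j _ => ?_
  conv_rhs => rw [Finset.sum_comm]
  exact Finset.sum_congr rfl fun v _ => Finset.sum_congr rfl fun u _ => by ring

theorem norm_fockMatrix_le {m : ℕ} (a : Matrix (Fin m) (Fin m) S.cover.CovAlg)
    (E : Finset (List (Fin n))) (y : S.Tail) :
    ‖(Matrix.of fun p q : Fin m × E => S.fockEntry (a p.1 q.1) p.2 q.2 y :
      Matrix (Fin m × E) (Fin m × E) ℂ)‖ ≤ ‖S.regularRep.evalMatrix a‖ := by
  rw [← Matrix.l2_opNorm_toEuclideanCLM]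
  refine opNorm_le_of_norm_inner_le (norm_nonneg _) fun η ξ => ?_
  rw [← inner_orbitSum_evalMatrix, ← S.norm_orbitSum y η, ← S.norm_orbitSum y ξ]
  calc _ ≤ ‖S.orbitSum y ξ‖ * ‖S.regularRep.evalMatrix a (S.orbitSum y η)‖ :=
        norm_inner_le_norm _ _
    _ ≤ ‖S.orbitSum y ξ‖ * (‖S.regularRep.evalMatrix a‖ * ‖S.orbitSum y η‖) := by
        gcongr
        exact ContinuousLinearMap.le_opNorm _ _
    _ = _ := by ring

end MultiSystem

namespace RowRep

variable {n : ℕ} {X : Type u} [TopologicalSpace X] [T2Space X] {S : MultiSystem n X}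
  {H : Type u} [NormedAddCommGroup H] [InnerProductSpace ℂ H] [CompleteSpace H]
  (ρ : RowRep S.cover H)

theorem inner_poisson_π_fockEntry (a : S.cover.CovAlg) (N : ℕ) (v : List (Fin n)) (x z : H) :
    ∑ u ∈ wordsLT n N, inner ℂ (ρ.poisson u z) (ρ.π (S.fockEntry a u v) (ρ.poisson v x)) =
      ∑ w ∈ a.support, if w.length + v.length < N then
        inner ℂ (ρ.poisson v (star (ρ.word w) z)) (ρ.poisson v (ρ.π (a w) x)) else 0 := by
  simp only [MultiSystem.fockEntry, map_sum, sum_apply, inner_sum]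
  rw [Finset.sum_comm]
  refine Finset.sum_congr rfl fun w _ => ?_
  have hterm : ∀ u, inner ℂ (ρ.poisson u z)
      (ρ.π (if u = w ++ v then S.cover.pullWord v (a w) else 0) (ρ.poisson v x)) =
      if u = w ++ v then
        inner ℂ (ρ.poisson v (star (ρ.word w) z)) (ρ.poisson v (ρ.π (a w) x)) else 0 := by
    intro u
    split_ifs with hu
    · rw [hu, poisson_append, π_pullWord_poisson]
    · simp
  simp only [hterm, Finset.sum_ite_eq', mem_wordsLT, List.length_append]

theorem sum_inner_poisson_π_fockEntry (a : S.cover.CovAlg) (N : ℕ) (x z : H) :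
    ∑ u ∈ wordsLT n N, ∑ v ∈ wordsLT n N,
        inner ℂ (ρ.poisson u z) (ρ.π (S.fockEntry a u v) (ρ.poisson v x)) =
      ∑ w ∈ a.support, ∑ v ∈ wordsLT n (N - w.length),
        inner ℂ (ρ.poisson v (star (ρ.word w) z)) (ρ.poisson v (ρ.π (a w) x)) := by
  rw [Finset.sum_comm]
  simp only [inner_poisson_π_fockEntry]
  rw [Finset.sum_comm]
  refine Finset.sum_congr rfl fun w _ => ?_
  rw [← Finset.sum_filter]
  refine Finset.sum_congr (Finset.ext fun v => ?_) fun _ _ => rfl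
  simp only [Finset.mem_filter, mem_wordsLT]
  omega

variable {ρ} in
theorem IsPure.tendsto_sum_inner_poisson_π_fockEntry (hρ : ρ.IsPure) (a : S.cover.CovAlg)
    (x z : H) :
    Filter.Tendsto (fun N => ∑ u ∈ wordsLT n N, ∑ v ∈ wordsLT n N,
        inner ℂ (ρ.poisson u z) (ρ.π (S.fockEntry a u v) (ρ.poisson v x)))
      Filter.atTop (nhds (inner ℂ z (ρ.eval a x))) := by
  simp only [ρ.sum_inner_poisson_π_fockEntry, ρ.inner_eval]
  exact tendsto_finsetSum _ fun w _ =>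
    (hρ.tendsto_sum_inner_poisson _ _).comp (Filter.tendsto_sub_atTop_nat w.length)

/-- The truncation of the Poisson kernel of `ρ` to words of length less than `N`, on `H^m`. -/
def poissonSum {m : ℕ} (N : ℕ) (x : PiLp 2 fun _ : Fin m => H) :
    PiLp 2 fun _ : Fin m × wordsLT n N => H :=
  WithLp.toLp 2 fun q => ρ.poisson q.2 (x q.1)

theorem norm_poissonSum_le {m : ℕ} (N : ℕ) (x : PiLp 2 fun _ : Fin m => H) :
    ‖ρ.poissonSum N x‖ ≤ ‖x‖ := by
  refine (sq_le_sq₀ (norm_nonneg _) (norm_nonneg _)).1 ?_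
  rw [PiLp.norm_sq_eq_of_L2, PiLp.norm_sq_eq_of_L2, Fintype.sum_prod_type]
  refine Finset.sum_le_sum fun j _ => ?_
  exact (Finset.sum_coe_sort _ fun v => ‖ρ.poisson v (x j)‖ ^ 2).trans_le
    (ρ.sum_norm_poisson_sq_le N (x j))

theorem norm_inner_poissonSum_le {m : ℕ} (a : Matrix (Fin m) (Fin m) S.cover.CovAlg) (N : ℕ)
    (x z : PiLp 2 fun _ : Fin m => H) :
    ‖∑ i, ∑ j, ∑ u ∈ wordsLT n N, ∑ v ∈ wordsLT n N,
        inner ℂ (ρ.poisson u (z i)) (ρ.π (S.fockEntry (a i j) u v) (ρ.poisson v (x j)))‖ ≤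
      ‖S.regularRep.evalMatrix a‖ * ‖x‖ * ‖z‖ := by
  let M : Matrix (Fin m × wordsLT n N) (Fin m × wordsLT n N) C₀(S.Tail, ℂ) :=
    Matrix.of fun p q => S.fockEntry (a p.1 q.1) p.2 q.2
  have hsum : ∑ i, ∑ j, ∑ u ∈ wordsLT n N, ∑ v ∈ wordsLT n N,
        inner ℂ (ρ.poisson u (z i)) (ρ.π (S.fockEntry (a i j) u v) (ρ.poisson v (x j))) =
      inner ℂ (ρ.poissonSum N z) (matOp _ H (M.map ρ.π) (ρ.poissonSum N x)) := by
    rw [inner_matOp]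
    simp only [Fintype.sum_prod_type]
    refine Finset.sum_congr rfl fun i _ => ?_
    conv_rhs => rw [Finset.sum_comm]
    refine Finset.sum_congr rfl fun j _ => ?_
    rw [← Finset.sum_coe_sort (wordsLT n N)]
    exact Finset.sum_congr rfl fun u _ => (Finset.sum_coe_sort (wordsLT n N) _).symm
  have hM : ‖matOp _ H (M.map ρ.π)‖ ≤ ‖S.regularRep.evalMatrix a‖ :=
    norm_matOp_map_le ρ.π M (norm_nonneg _) (S.norm_fockMatrix_le a _)
  rw [hsum]
  calc _ ≤ ‖ρ.poissonSum N z‖ * ‖matOp _ H (M.map ρ.π) (ρ.poissonSum N x)‖ :=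
        norm_inner_le_norm _ _
    _ ≤ ‖z‖ * (‖S.regularRep.evalMatrix a‖ * ‖x‖) := by
        gcongr
        · exact ρ.norm_poissonSum_le N z
        · exact (ContinuousLinearMap.le_of_opNorm_le _ hM _).trans
            (by gcongr; exact ρ.norm_poissonSum_le N x)
    _ = _ := by ring

variable {ρ} in
theorem IsPure.norm_evalMatrix_le_regularRep (hρ : ρ.IsPure) {m : ℕ}
    (a : Matrix (Fin m) (Fin m) S.cover.CovAlg) :
    ‖ρ.evalMatrix a‖ ≤ ‖S.regularRep.evalMatrix a‖ := by
  refine opNorm_le_of_norm_inner_le (norm_nonneg _) fun x z => ?_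
  rw [inner_evalMatrix]
  exact le_of_tendsto' (Filter.Tendsto.norm (tendsto_finsetSum _ fun i _ =>
    tendsto_finsetSum _ fun j _ => hρ.tendsto_sum_inner_poisson_π_fockEntry (a i j) (x j) (z i)))
    fun N => ρ.norm_inner_poissonSum_le a N x z

theorem norm_evalMatrix_le_regularRep {m : ℕ} (a : Matrix (Fin m) (Fin m) S.cover.CovAlg) :
    ‖ρ.evalMatrix a‖ ≤ ‖S.regularRep.evalMatrix a‖ := by
  refine opNorm_le_of_norm_inner_le (norm_nonneg _) fun x z => ?_
  let q : ℂ → ℂ := fun c => ∑ i, ∑ j, ∑ w ∈ (a i j).support,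
    inner ℂ (star (c ^ w.length • ρ.word w) (z i)) (ρ.π (a i j w) (x j))
  have hq : ∀ c, (hc : ‖c‖ < 1) → inner ℂ z ((ρ.scale hc.le).evalMatrix a x) = q c := by
    intro c hc
    simp only [q, inner_evalMatrix, inner_eval, scale_word]
    rfl
  have hq_one : inner ℂ z (ρ.evalMatrix a x) = q 1 := by
    simp only [q, inner_evalMatrix, inner_eval, one_pow, one_smul]
  have hcont : Continuous fun r : ℝ => ‖q r‖ := by
    simp only [q, star_smul]
    fun_prop
  have hlim : Filter.Tendsto (fun r : ℝ => ‖q r‖) (nhdsWithin 1 (Set.Ioo 0 1)) (nhds ‖q 1‖) := by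
    simpa using (hcont.tendsto 1).mono_left nhdsWithin_le_nhds
  have : (nhdsWithin (1 : ℝ) (Set.Ioo 0 1)).NeBot := right_nhdsWithin_Ioo_neBot one_pos
  rw [hq_one]
  refine le_of_tendsto hlim ?_
  filter_upwards [self_mem_nhdsWithin] with r hr
  have hr' : ‖(r : ℂ)‖ < 1 := by
    rw [Complex.norm_real, Real.norm_of_nonneg hr.1.le]
    exact hr.2
  rw [← hq r hr']
  calc _ ≤ ‖z‖ * ‖(ρ.scale hr'.le).evalMatrix a x‖ := norm_inner_le_norm _ _
    _ ≤ ‖z‖ * (‖S.regularRep.evalMatrix a‖ * ‖x‖) := by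
        gcongr
        exact ContinuousLinearMap.le_of_opNorm_le _
          ((ρ.isPure_scale hr').norm_evalMatrix_le_regularRep a) x
    _ = _ := by ring

theorem regularRep_isCompletelyIsometric : S.regularRep.IsCompletelyIsometric := by
  intro m a
  refine (IsGreatest.csSup_eq (s := {r | ∃ (K : Type u) (_ : NormedAddCommGroup K)
    (_ : InnerProductSpace ℂ K) (_ : CompleteSpace K) (ρ : RowRep S.cover K),
    r = ‖ρ.evalMatrix a‖}) ⟨⟨_, _, _, inferInstance, S.regularRep, rfl⟩, ?_⟩).symm
  rintro _ ⟨K, _, _, _, ρ, rfl⟩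
  exact ρ.norm_evalMatrix_le_regularRep a

end RowRep

/-! ### Cuntz relations in the C*-envelope -/

namespace RowRep

section General

variable {n : ℕ} {Y : Type u} [TopologicalSpace Y] {S : MultiSystem n Y}
  {H : Type u} [NormedAddCommGroup H] [InnerProductSpace ℂ H] [CompleteSpace H] (ρ : RowRep S H)

theorem eval_single (w : List (Fin n)) (f : C₀(Y, ℂ)) :
    ρ.eval (Finsupp.single w f) = ρ.word w * ρ.π f :=
  Finsupp.sum_single_index (by rw [map_zero, mul_zero])

theorem norm_evalMatrix_unique (a : S.CovAlg) :
    ‖ρ.evalMatrix (Matrix.of fun _ _ : Fin 1 => a)‖ = ‖ρ.eval a‖ := by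
  have hnorm : ∀ x : PiLp 2 fun _ : Fin 1 => H, ‖x‖ = ‖x 0‖ := fun x => by
    simp [PiLp.norm_eq_of_L2]
  have happly : ∀ x, ρ.evalMatrix (Matrix.of fun _ _ : Fin 1 => a) x 0 = ρ.eval a (x 0) :=
    fun x => (matOp_apply _ _ _).trans (by simp)
  refine le_antisymm (ContinuousLinearMap.opNorm_le_bound _ (norm_nonneg _) fun x => ?_)
    (ContinuousLinearMap.opNorm_le_bound _ (norm_nonneg _) fun x => ?_)
  · rw [hnorm, happly, hnorm x]
    exact (ρ.eval a).le_opNorm _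
  · have h := (ρ.evalMatrix (Matrix.of fun _ _ : Fin 1 => a)).le_opNorm (WithLp.toLp 2 fun _ => x)
    rwa [hnorm, happly, hnorm] at h

/-- The generator `𝔱_w f` of `C*(ρ(𝒜))`. -/
def cstarGen (w : List (Fin n)) (f : C₀(Y, ℂ)) : ρ.cstar :=
  ⟨ρ.word w * ρ.π f, ρ.eval_single w f ▸ ρ.eval_mem_cstar _⟩

variable {ρ} in
theorem IsCStarEnvelope.exists_starHom (hρ : ρ.IsCStarEnvelope) {K : Type u}
    [NormedAddCommGroup K] [InnerProductSpace ℂ K] [CompleteSpace K] {ρ' : RowRep S K}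
    (hρ' : ρ'.IsCompletelyIsometric) : ∃ φ : ρ'.cstar →⋆ₙₐ[ℂ] (H →L[ℂ] H),
      ∀ w f, φ (ρ'.cstarGen w f) = ρ.word w * ρ.π f := by
  obtain ⟨q, -, hq⟩ := hρ.2 K ρ' hρ'
  refine ⟨(NonUnitalStarSubalgebraClass.subtype ρ.cstar).comp q, fun w f => ?_⟩
  have hgen : ρ'.cstarGen w f = ⟨ρ'.eval (Finsupp.single w f), ρ'.eval_mem_cstar _⟩ :=
    Subtype.ext (ρ'.eval_single w f).symm
  rw [hgen, ← ρ.eval_single]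
  exact congrArg Subtype.val (hq _)

theorem star_T_mul_π (i : Fin n) (f : C₀(Y, ℂ)) :
    star (ρ.T i) * ρ.π f = ρ.π (S.pullback i f) * star (ρ.T i) := by
  have h := ρ.star_word_mul_π [i] f
  rwa [word_singleton] at h

theorem mul_π_eq_of_commute {A B : H →L[ℂ] H} (hA : ∀ f, Commute (ρ.π f) A)
    (hB : ∀ f, Commute (ρ.π f) B) (h : ∀ f g, ρ.π f * A * ρ.π g = ρ.π f * B * ρ.π g)
    (f : C₀(Y, ℂ)) : A * ρ.π f = B * ρ.π f := by
  have hD : ∀ g, Commute (ρ.π g) (A - B) := fun g => (hA g).sub_right (hB g)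
  rw [← sub_eq_zero, ← sub_mul, ← CStarRing.mul_star_self_eq_zero_iff, star_mul, ← map_star]
  calc (A - B) * ρ.π f * (ρ.π (star f) * star (A - B))
      = ρ.π f * (A - B) * ρ.π (star f) * star (A - B) := by rw [(hD f).eq, ← mul_assoc]
    _ = 0 := by rw [mul_sub, sub_mul, h, sub_self, zero_mul]

end General

variable {n : ℕ} {X : Type u} [TopologicalSpace X] [T2Space X] {S : MultiSystem n X}
  {H : Type u} [NormedAddCommGroup H] [InnerProductSpace ℂ H] [CompleteSpace H]
  {ρ : RowRep S.cover H}

variable (ρ) in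
theorem π_shiftPull_mul_T (i : Fin n) (f : C₀(S.Tail, ℂ)) :
    ρ.π (S.shiftPull f) * ρ.T i = ρ.T i * ρ.π f := by
  rw [ρ.covariant, S.pullback_shiftPull]

variable (ρ) in
theorem commute_π_star_T_mul_T (i j : Fin n) (f : C₀(S.Tail, ℂ)) :
    Commute (ρ.π f) (star (ρ.T i) * ρ.T j) := by
  have h := ρ.star_T_mul_π i (S.shiftPull f)
  rw [S.pullback_shiftPull] at h
  rw [commute_iff_eq, ← mul_assoc, ← h, mul_assoc, π_shiftPull_mul_T, mul_assoc]

theorem norm_le_norm_regularPi (f : C₀(S.Tail, ℂ)) : ‖f‖ ≤ ‖S.regularPi f‖ := by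
  refine (zeroAtInfty_norm_le (norm_nonneg _)).2 fun y => ?_
  have h := (S.regularPi f).le_opNorm (EllTwo.basisVec (y, 0))
  have hnorm : ‖EllTwo.basisVec (y, (0 : ℤ))‖ = 1 := (S.orthonormal_orbitVec y).1 []
  rwa [S.regularPi_basisVec, norm_smul, hnorm, mul_one, mul_one] at h

theorem IsCompletelyIsometric.norm_le_norm_π (hρ : ρ.IsCompletelyIsometric)
    (f : C₀(S.Tail, ℂ)) : ‖f‖ ≤ ‖ρ.π f‖ := by
  have heval : ∀ {K : Type u} [NormedAddCommGroup K] [InnerProductSpace ℂ K] [CompleteSpace K]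
      (ρ' : RowRep S.cover K), ρ'.IsCompletelyIsometric → ‖ρ'.π f‖ =
        S.cover.tensorNorm (Matrix.of fun _ _ : Fin 1 => Finsupp.single [] f) := by
    intro K _ _ _ ρ' hρ'
    rw [← hρ', norm_evalMatrix_unique, eval_single, word_nil, one_mul]
  rw [heval ρ hρ, ← heval _ regularRep_isCompletelyIsometric]
  exact norm_le_norm_regularPi f

/-- The Cuntz relations, relative to the range of `π`, and faithfulness of `π`; a representation
generating the C*-envelope has these properties. -/
structure IsCuntz (ρ : RowRep S.cover H) : Prop where
  star_T_mul_T_mul_π : ∀ i j f, star (ρ.T i) * ρ.T j * ρ.π f = if i = j then ρ.π f else 0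
  sum_T_mul_star_T_mul_π : ∀ f, ∑ i, ρ.T i * star (ρ.T i) * ρ.π f = ρ.π f
  norm_le_norm_π : ∀ f, ‖f‖ ≤ ‖ρ.π f‖

theorem IsCStarEnvelope.π_mul_star_T_mul_T_mul_π (hρ : ρ.IsCStarEnvelope) (i j : Fin n)
    (f g : C₀(S.Tail, ℂ)) :
    ρ.π f * (star (ρ.T i) * ρ.T j) * ρ.π g = if i = j then ρ.π (f * g) else 0 := by
  obtain ⟨φ, hφ⟩ := hρ.exists_starHom regularRep_isCompletelyIsometric
  have hgen : star (S.regularRep.cstarGen [i] (star f)) * S.regularRep.cstarGen [j] g =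
      if i = j then S.regularRep.cstarGen [] (f * g) else 0 := by
    apply Subtype.ext
    change star (S.regularRep.word [i] * S.regularRep.π (star f)) *
      (S.regularRep.word [j] * S.regularRep.π g) = _
    have hT : star (S.regularRep.T i) * S.regularRep.T j = if i = j then 1 else 0 :=
      S.star_regularT_mul_regularT i j
    rw [word_singleton, word_singleton, star_mul, map_star, star_star, mul_assoc,
      ← mul_assoc (star (S.regularRep.T i)), hT]
    split_ifs with hij
    · rw [one_mul, ← map_mul]
      exact (one_mul _).symm
    · simp
  have h := congrArg φ hgen
  rw [map_mul, map_star, hφ, hφ, word_singleton, word_singleton, star_mul, map_star,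
    star_star] at h
  rw [mul_assoc, mul_assoc, ← mul_assoc, h]
  split_ifs
  · rw [hφ, word_nil, one_mul]
  · exact map_zero φ

theorem IsCStarEnvelope.π_mul_rangeSum_mul_π (hρ : ρ.IsCStarEnvelope) (f g : C₀(S.Tail, ℂ)) :
    ρ.π f * ρ.rangeSum * ρ.π g = ρ.π (f * g) := by
  obtain ⟨φ, hφ⟩ := hρ.exists_starHom regularRep_isCompletelyIsometric
  have hexpand : ∀ {K : Type u} [NormedAddCommGroup K] [InnerProductSpace ℂ K]
      [CompleteSpace K] (ρ' : RowRep S.cover K), ρ'.π f * ρ'.rangeSum * ρ'.π g =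
      ∑ i, ρ'.word [i] * ρ'.π (S.cover.pullback i f) *
        star (ρ'.word [i] * ρ'.π (S.cover.pullback i (star g))) := by
    intro K _ _ _ ρ'
    simp only [rangeSum, Finset.mul_sum, Finset.sum_mul, word_singleton, ← ρ'.covariant, star_mul,
      map_star, star_star, mul_assoc]
  have hgen : ∑ i, S.regularRep.cstarGen [i] (S.cover.pullback i f) *
      star (S.regularRep.cstarGen [i] (S.cover.pullback i (star g))) =
      S.regularRep.cstarGen [] (f * g) := by
    apply Subtype.ext
    have hone : S.regularRep.rangeSum = 1 := S.sum_regularT_mul_star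
    calc _ = S.regularRep.π f * S.regularRep.rangeSum * S.regularRep.π g := by
          rw [hexpand]
          exact map_sum (NonUnitalStarSubalgebraClass.subtype S.regularRep.cstar) _ _
      _ = 1 * S.regularRep.π (f * g) := by rw [hone, mul_one, map_mul, one_mul]
  have h := congrArg φ hgen
  rw [map_sum, hφ, word_nil, one_mul] at h
  rw [hexpand, ← h]
  simp only [map_mul φ, map_star φ, hφ]

theorem IsCStarEnvelope.isCuntz (hρ : ρ.IsCStarEnvelope) : ρ.IsCuntz where
  star_T_mul_T_mul_π i j f := by
    have h := ρ.mul_π_eq_of_commute (B := if i = j then 1 else 0)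
      (ρ.commute_π_star_T_mul_T i j) (fun _ => by split_ifs <;> simp) (fun f g => by
        rw [hρ.π_mul_star_T_mul_T_mul_π]
        split_ifs <;> simp) f
    rw [h]
    split_ifs <;> simp
  sum_T_mul_star_T_mul_π f := by
    rw [← Finset.sum_mul, ← rangeSum]
    simpa using ρ.mul_π_eq_of_commute (fun g => (ρ.commute_rangeSum_π g).symm)
      (fun _ => Commute.one_right _)
      (fun f g => by rw [hρ.π_mul_rangeSum_mul_π, mul_one, map_mul]) f
  norm_le_norm_π := hρ.1.norm_le_norm_π

end RowRep

/-! ### Matrix units over `C₀(X̃)` -/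

namespace RowRep

section General

variable {n : ℕ} {Y : Type u} [TopologicalSpace Y] {S : MultiSystem n Y}
  {H : Type u} [NormedAddCommGroup H] [InnerProductSpace ℂ H] [CompleteSpace H] (ρ : RowRep S H)

/-- The element `𝔱_u f 𝔱_v^*`, as a linear map in `f`: a matrix unit with coefficient `f`. -/
def matUnit (u v : List (Fin n)) : C₀(Y, ℂ) →ₗ[ℂ] (H →L[ℂ] H) where
  toFun f := ρ.word u * ρ.π f * star (ρ.word v)
  map_add' f g := by simp [mul_add, add_mul]
  map_smul' c f := by simp

theorem matUnit_apply (u v : List (Fin n)) (f : C₀(Y, ℂ)) :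
    ρ.matUnit u v f = ρ.word u * ρ.π f * star (ρ.word v) := rfl

theorem matUnit_nil (f : C₀(Y, ℂ)) : ρ.matUnit [] [] f = ρ.π f := by
  simp [matUnit_apply, word_nil]

theorem star_matUnit (u v : List (Fin n)) (f : C₀(Y, ℂ)) :
    star (ρ.matUnit u v f) = ρ.matUnit v u (star f) := by
  simp [matUnit_apply, mul_assoc, map_star]

theorem T_mul_matUnit_mul_star_T (i j : Fin n) (u v : List (Fin n)) (f : C₀(Y, ℂ)) :
    ρ.T i * ρ.matUnit u v f * star (ρ.T j) = ρ.matUnit (i :: u) (j :: v) f := by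
  simp only [matUnit_apply, word_cons, star_mul, mul_assoc]

theorem matUnit_mul_π (u v : List (Fin n)) (f g : C₀(Y, ℂ)) :
    ρ.matUnit u v f * ρ.π g = ρ.matUnit u v (f * S.pullWord v g) := by
  rw [matUnit_apply, mul_assoc, star_word_mul_π, matUnit_apply, map_mul]
  simp only [mul_assoc]

theorem norm_π_le (f : C₀(Y, ℂ)) : ‖ρ.π f‖ ≤ ‖f‖ := NonUnitalStarAlgHom.norm_apply_le ρ.π f

/-- The column `[𝔱_w^*]`, where `w` runs through the words of length `k`. -/
def wordColumn (k : ℕ) (x : H) : PiLp 2 fun _ : words n k => H :=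
  WithLp.toLp 2 fun w => star (ρ.word w) x

theorem norm_wordColumn_le (k : ℕ) (x : H) : ‖ρ.wordColumn k x‖ ≤ ‖x‖ := by
  rw [PiLp.norm_eq_of_L2]
  refine Real.sqrt_le_iff.2 ⟨norm_nonneg x, ?_⟩
  exact (Finset.sum_coe_sort (words n k) fun w => ‖star (ρ.word w) x‖ ^ 2).trans_le
    (ρ.sum_norm_star_word_sq_le k x)

theorem norm_sum_smul_star_word_le {k : ℕ} (ξ : EuclideanSpace ℂ (words n k)) :
    ‖∑ w, star (ξ w) • star (ρ.word w)‖ ≤ ‖ξ‖ := by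
  refine ContinuousLinearMap.opNorm_le_bound _ (norm_nonneg ξ) fun x => ?_
  calc ‖(∑ w, star (ξ w) • star (ρ.word w)) x‖ = ‖∑ w, star (ξ w) • ρ.wordColumn k x w‖ := by
        rw [sum_apply]; rfl
    _ ≤ ∑ w, ‖ξ w‖ * ‖ρ.wordColumn k x w‖ :=
        (norm_sum_le _ _).trans_eq (by simp only [norm_smul, norm_star])
    _ ≤ ‖ξ‖ * ‖ρ.wordColumn k x‖ := by
        simpa only [PiLp.norm_eq_of_L2] using Real.sum_mul_le_sqrt_mul_sqrt _ _ _
    _ ≤ ‖ξ‖ * ‖x‖ := by gcongr; exact ρ.norm_wordColumn_le k x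

theorem norm_word_le_one (w : List (Fin n)) : ‖ρ.word w‖ ≤ 1 := by
  rw [← norm_star]
  refine ContinuousLinearMap.opNorm_le_bound _ zero_le_one fun x => ?_
  rw [one_mul]
  exact (PiLp.norm_apply_le (ρ.wordColumn w.length x) ⟨w, mem_words.2 rfl⟩).trans
    (ρ.norm_wordColumn_le _ x)

theorem norm_word_mul_π_le (w : List (Fin n)) (f : C₀(Y, ℂ)) : ‖ρ.word w * ρ.π f‖ ≤ ‖f‖ :=
  calc ‖ρ.word w * ρ.π f‖ ≤ ‖ρ.word w‖ * ‖ρ.π f‖ := norm_mul_le _ _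
    _ ≤ 1 * ‖f‖ := by gcongr; exacts [ρ.norm_word_le_one w, ρ.norm_π_le f]
    _ = ‖f‖ := one_mul _

theorem norm_matUnit_le (u v : List (Fin n)) (f : C₀(Y, ℂ)) : ‖ρ.matUnit u v f‖ ≤ ‖f‖ :=
  calc ‖ρ.matUnit u v f‖ ≤ ‖ρ.word u * ρ.π f‖ * ‖star (ρ.word v)‖ := norm_mul_le _ _
    _ ≤ ‖f‖ * 1 := by
      gcongr
      · exact ρ.norm_word_mul_π_le u f
      · exact (norm_star _).trans_le (ρ.norm_word_le_one v)
    _ = ‖f‖ := mul_one _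

/-- The image `∑ 𝔱_u f_{u,v} 𝔱_v^*` of a matrix `f` over `C₀` indexed by the words of length `k`. -/
def levelMap (k : ℕ) : Matrix (words n k) (words n k) C₀(Y, ℂ) →ₗ[ℂ] (H →L[ℂ] H) where
  toFun f := ∑ u : words n k, ∑ v : words n k, ρ.matUnit u v (f u v)
  map_add' f g := by simp [Finset.sum_add_distrib]
  map_smul' c f := by simp [Finset.smul_sum]

theorem levelMap_apply {k : ℕ} (f : Matrix (words n k) (words n k) C₀(Y, ℂ)) :
    ρ.levelMap k f = ∑ u : words n k, ∑ v : words n k, ρ.matUnit u v (f u v) := rfl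

theorem levelMap_single {k : ℕ} (u v : words n k) (f : C₀(Y, ℂ)) :
    ρ.levelMap k (Matrix.single u v f) = ρ.matUnit u v f := by
  rw [levelMap_apply, Finset.sum_eq_single u, Finset.sum_eq_single v]
  · rw [Matrix.single_apply_same]
  · intro q _ hq
    rw [Matrix.single_apply_of_ne _ _ _ _ _ fun h => hq h.2.symm, map_zero]
  · simp
  · intro p _ hp
    refine Finset.sum_eq_zero fun q _ => ?_
    rw [Matrix.single_apply_of_ne _ _ _ _ _ fun h => hp h.1.symm, map_zero]
  · simp

open scoped Matrix.Norms.L2Operator in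
theorem norm_levelMap_le {k : ℕ} {f : Matrix (words n k) (words n k) C₀(Y, ℂ)} {c : ℝ}
    (hc : 0 ≤ c) (hf : ∀ y, ‖f.map fun g => g y‖ ≤ c) : ‖ρ.levelMap k f‖ ≤ c := by
  refine opNorm_le_of_norm_inner_le hc fun x z => ?_
  have hinner : inner ℂ z (ρ.levelMap k f x) =
      inner ℂ (ρ.wordColumn k z) (matOp (words n k) H (f.map ρ.π) (ρ.wordColumn k x)) := by
    simp only [inner_matOp, levelMap_apply, sum_apply, inner_sum, matUnit_apply,
      mul_apply_eq_comp, inner_apply_eq_inner_star (ρ.word _)]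
    rfl
  calc ‖inner ℂ z (ρ.levelMap k f x)‖
      ≤ ‖ρ.wordColumn k z‖ * ‖matOp (words n k) H (f.map ρ.π) (ρ.wordColumn k x)‖ :=
        hinner ▸ norm_inner_le_norm _ _
    _ ≤ ‖z‖ * (c * ‖x‖) := by
        gcongr
        · exact ρ.norm_wordColumn_le k z
        · exact ContinuousLinearMap.le_of_opNorm_le_of_le _ (norm_matOp_map_le ρ.π f hc hf)
            (ρ.norm_wordColumn_le k x)
    _ = c * ‖x‖ * ‖z‖ := by ring

end General

variable {n : ℕ} {X : Type u} [TopologicalSpace X] [T2Space X] {S : MultiSystem n X}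
  {H : Type u} [NormedAddCommGroup H] [InnerProductSpace ℂ H] [CompleteSpace H]
  {ρ : RowRep S.cover H}

variable (ρ) in
theorem exists_word_mul_π_eq (v : List (Fin n)) (f : C₀(S.Tail, ℂ)) :
    ∃ g, ρ.word v * ρ.π f = ρ.π g * ρ.word v := by
  induction v with
  | nil => exact ⟨f, by simp [word_nil]⟩
  | cons i v ih =>
    obtain ⟨g, hg⟩ := ih
    exact ⟨S.shiftPull g, by
      rw [word_cons, mul_assoc, hg, ← mul_assoc, ← mul_assoc, π_shiftPull_mul_T]⟩

namespace IsCuntz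

variable (hρ : ρ.IsCuntz)
include hρ

theorem star_word_mul_word_mul_π {u v : List (Fin n)} (huv : u.length = v.length)
    (f : C₀(S.Tail, ℂ)) :
    star (ρ.word u) * ρ.word v * ρ.π f = if u = v then ρ.π f else 0 := by
  induction u generalizing v with
  | nil =>
    obtain rfl := List.length_eq_zero_iff.1 huv.symm
    simp [word_nil]
  | cons i u ih =>
    cases v with
    | nil => simp at huv
    | cons j v =>
      obtain ⟨g, hg⟩ := ρ.exists_word_mul_π_eq v f
      calc star (ρ.word (i :: u)) * ρ.word (j :: v) * ρ.π f
          = star (ρ.word u) * (star (ρ.T i) * ρ.T j * (ρ.word v * ρ.π f)) := by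
            simp only [word_cons, star_mul, mul_assoc]
        _ = star (ρ.word u) * (if i = j then ρ.π g * ρ.word v else 0) := by
            rw [hg, ← mul_assoc _ (ρ.π g), hρ.star_T_mul_T_mul_π, ite_mul, zero_mul]
        _ = if i = j then star (ρ.word u) * ρ.word v * ρ.π f else 0 := by
            rw [← hg, mul_ite, mul_zero, mul_assoc]
        _ = if i :: u = j :: v then ρ.π f else 0 := by
            simp only [ih (by simpa using huv), List.cons.injEq, ite_and]

theorem matUnit_mul_matUnit {p q : List (Fin n)} (h : p.length = q.length) (u v : List (Fin n))
    (f g : C₀(S.Tail, ℂ)) :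
    ρ.matUnit u p f * ρ.matUnit q v g = if p = q then ρ.matUnit u v (f * g) else 0 := by
  calc ρ.matUnit u p f * ρ.matUnit q v g
      = ρ.word u * ρ.π f * (star (ρ.word p) * ρ.word q * ρ.π g) * star (ρ.word v) := by
        simp only [matUnit_apply, mul_assoc]
    _ = if p = q then ρ.matUnit u v (f * g) else 0 := by
        rw [hρ.star_word_mul_word_mul_π h]
        split_ifs
        · rw [matUnit_apply, map_mul, ← mul_assoc]
        · simp

theorem matUnit_mul_matUnit_same (u p v : List (Fin n)) (f g : C₀(S.Tail, ℂ)) :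
    ρ.matUnit u p f * ρ.matUnit p v g = ρ.matUnit u v (f * g) := by
  rw [hρ.matUnit_mul_matUnit rfl, if_pos rfl]

theorem matUnit_mul_π_mul_matUnit (u p v : List (Fin n)) (a f b : C₀(S.Tail, ℂ)) :
    ρ.matUnit u p a * ρ.π f * ρ.matUnit p v b = ρ.matUnit u v (a * S.cover.pullWord p f * b) := by
  rw [matUnit_mul_π, hρ.matUnit_mul_matUnit_same]

theorem matUnit_mul_matUnit_words {k : ℕ} (u v : List (Fin n)) (p q : words n k)
    (f g : C₀(S.Tail, ℂ)) :
    ρ.matUnit u p f * ρ.matUnit q v g = if p = q then ρ.matUnit u v (f * g) else 0 := by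
  simp only [hρ.matUnit_mul_matUnit ((mem_words.1 p.2).trans (mem_words.1 q.2).symm),
    Subtype.ext_iff]

theorem matUnit_mul_levelMap_mul_matUnit {k : ℕ}
    (f : Matrix (words n k) (words n k) C₀(S.Tail, ℂ)) (u v : List (Fin n)) (p q : words n k)
    (a b : C₀(S.Tail, ℂ)) :
    ρ.matUnit u p a * ρ.levelMap k f * ρ.matUnit q v b = ρ.matUnit u v (a * f p q * b) := by
  simp only [levelMap_apply, Finset.mul_sum, Finset.sum_mul, hρ.matUnit_mul_matUnit_words,
    Finset.sum_ite_irrel, Finset.sum_const_zero, Finset.sum_ite_eq, Finset.sum_ite_eq',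
    Finset.mem_univ, if_true]

theorem levelMap_mul {k : ℕ} (f g : Matrix (words n k) (words n k) C₀(S.Tail, ℂ)) :
    ρ.levelMap k (f * g) = ρ.levelMap k f * ρ.levelMap k g := by
  calc ρ.levelMap k (f * g)
      = ∑ u : words n k, ∑ v : words n k, ∑ p, ρ.matUnit u v (f u p * g p v) := by
        simp only [levelMap_apply, Matrix.mul_apply, map_sum]
    _ = ∑ p, ∑ v : words n k, ∑ u : words n k, ρ.matUnit u v (f u p * g p v) :=
        Finset.sum_comm_cycle.trans (Finset.sum_congr rfl fun p _ => Finset.sum_comm)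
    _ = ρ.levelMap k f * ρ.levelMap k g := by
        simp only [levelMap_apply, Finset.mul_sum, Finset.sum_mul, hρ.matUnit_mul_matUnit_words,
          Finset.sum_ite_eq', Finset.mem_univ, if_true]

theorem sum_matUnit_singleton (f : C₀(S.Tail, ℂ)) :
    ∑ i, ρ.matUnit [i] [i] (S.cover.pullback i f) = ρ.π f := by
  conv_rhs => rw [← hρ.sum_T_mul_star_T_mul_π f]
  refine Finset.sum_congr rfl fun i _ => ?_
  rw [matUnit_apply, word_singleton, mul_assoc, ← star_T_mul_π, mul_assoc]

theorem matUnit_eq_sum (u v : List (Fin n)) (f : C₀(S.Tail, ℂ)) :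
    ρ.matUnit u v f = ∑ i, ρ.matUnit (u ++ [i]) (v ++ [i]) (S.cover.pullback i f) := by
  rw [matUnit_apply, ← hρ.sum_matUnit_singleton f, Finset.mul_sum, Finset.sum_mul]
  refine Finset.sum_congr rfl fun i _ => ?_
  simp only [matUnit_apply, word_append, star_mul, mul_assoc]

theorem matUnit_self (u : List (Fin n)) (f : C₀(S.Tail, ℂ)) :
    ρ.matUnit u u f = ρ.π (S.pushWord u f) := by
  induction u with
  | nil => exact ρ.matUnit_nil f
  | cons i u ih =>
    rw [← T_mul_matUnit_mul_star_T, ih, MultiSystem.pushWord,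
      ← hρ.sum_matUnit_singleton (S.push i _), Finset.sum_eq_single i]
    · rw [S.pullback_push, if_pos rfl, matUnit_apply, word_singleton]
    · intro j _ hj
      rw [S.pullback_push, if_neg hj, map_zero]
    · simp

theorem norm_apply_le_norm_matUnit_self (u : List (Fin n)) (f : C₀(S.Tail, ℂ)) (y : S.Tail) :
    ‖f y‖ ≤ ‖ρ.matUnit u u f‖ := by
  rw [hρ.matUnit_self, ← S.pushWord_apply_wordMap u f y]
  exact (norm_zeroAtInfty_apply_le _ _).trans (hρ.norm_le_norm_π _)

end IsCuntz

end RowRep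

/-! ### The filtration of the core -/

/-- `I_F` as a subspace of `C₀(Y)`. -/
def vanishingSubmodule {Y : Type u} [TopologicalSpace Y] (F : Set Y) : Submodule ℂ C₀(Y, ℂ) where
  carrier := vanishingIdeal F
  zero_mem' _ _ := rfl
  add_mem' hf hg x hx := by
    rw [ZeroAtInftyContinuousMap.add_apply, hf x hx, hg x hx, add_zero]
  smul_mem' c f hf x hx := by
    rw [ZeroAtInftyContinuousMap.smul_apply, hf x hx, smul_zero]

theorem mul_mem_vanishingSubmodule {Y : Type u} [TopologicalSpace Y] {F : Set Y} (f : C₀(Y, ℂ))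
    {g : C₀(Y, ℂ)} (hg : g ∈ vanishingSubmodule F) : f * g ∈ vanishingSubmodule F := fun x hx => by
  rw [ZeroAtInftyContinuousMap.mul_apply, hg x hx, mul_zero]

namespace RowRep

section General

variable {n : ℕ} {Y : Type u} [TopologicalSpace Y] {S : MultiSystem n Y}
  {H : Type u} [NormedAddCommGroup H] [InnerProductSpace ℂ H] [CompleteSpace H] (ρ : RowRep S H)

/-- The span of the elements `𝔱_u f 𝔱_v^*` with `|u| = |v| = k` and `f ∈ I`, as the image of the
matrices with entries in `I`. -/
def level (I : Submodule ℂ C₀(Y, ℂ)) (k : ℕ) : Submodule ℂ (H →L[ℂ] H) :=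
  Submodule.map (ρ.levelMap k)
    { carrier := {f | ∀ u v, f u v ∈ I}
      zero_mem' := fun _ _ => I.zero_mem
      add_mem' := fun hf hg u v => I.add_mem (hf u v) (hg u v)
      smul_mem' := fun c _ hf u v => I.smul_mem c (hf u v) }

variable {ρ}

theorem mem_level {I : Submodule ℂ C₀(Y, ℂ)} {k : ℕ} {b : H →L[ℂ] H} :
    b ∈ ρ.level I k ↔ ∃ f, (∀ u v, f u v ∈ I) ∧ ρ.levelMap k f = b := Iff.rfl

theorem matUnit_mem_level {I : Submodule ℂ C₀(Y, ℂ)} {k : ℕ} {u v : List (Fin n)} {f : C₀(Y, ℂ)}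
    (hu : u.length = k) (hv : v.length = k) (hf : f ∈ I) : ρ.matUnit u v f ∈ ρ.level I k := by
  refine mem_level.2 ⟨Matrix.single ⟨u, mem_words.2 hu⟩ ⟨v, mem_words.2 hv⟩ f, fun p q => ?_,
    ρ.levelMap_single _ _ f⟩
  rw [Matrix.single_apply]
  split_ifs
  exacts [hf, I.zero_mem]

theorem level_le {I : Submodule ℂ C₀(Y, ℂ)} {k : ℕ} {M : Submodule ℂ (H →L[ℂ] H)}
    (h : ∀ u v : List (Fin n), u.length = k → v.length = k → ∀ f ∈ I, ρ.matUnit u v f ∈ M) :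
    ρ.level I k ≤ M := by
  rintro _ ⟨f, hf, rfl⟩
  exact M.sum_mem fun u _ => M.sum_mem fun v _ =>
    h u v (mem_words.1 u.2) (mem_words.1 v.2) (f u v) (hf u v)

theorem matUnit_mem_coreAlg {u v : List (Fin n)} (huv : u.length = v.length) (f : C₀(Y, ℂ)) :
    ρ.matUnit u v f ∈ ρ.coreAlg :=
  Submodule.le_topologicalClosure _ (Submodule.subset_span ⟨u, v, f, huv, rfl⟩)

variable (ρ)

theorem π_mem_coreAlg (f : C₀(Y, ℂ)) : ρ.π f ∈ ρ.coreAlg :=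
  ρ.matUnit_nil f ▸ matUnit_mem_coreAlg rfl f

theorem coreAlg_eq : ρ.coreAlg = (⨆ k, ρ.level ⊤ k).topologicalClosure := by
  refine congrArg Submodule.topologicalClosure (le_antisymm (Submodule.span_le.2 ?_)
    (iSup_le fun k => level_le fun u v hu hv f _ => ?_))
  · rintro _ ⟨u, v, f, huv, rfl⟩
    exact Submodule.mem_iSup_of_mem u.length (matUnit_mem_level rfl huv.symm trivial)
  · exact Submodule.subset_span ⟨u, v, f, hu.trans hv.symm, rfl⟩

/-- `α` as a bounded operator. -/
def endoCLM : (H →L[ℂ] H) →L[ℂ] (H →L[ℂ] H) :=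
  (n : ℂ)⁻¹ • ∑ i, ∑ j, ContinuousLinearMap.mulLeftRight ℂ _ (ρ.T i) (star (ρ.T j))

theorem endoCLM_apply (b : H →L[ℂ] H) : ρ.endoCLM b = ρ.endo b := by
  simp only [endoCLM, endo, smul_apply, sum_apply, ContinuousLinearMap.mulLeftRight_apply]

theorem endo_matUnit (u v : List (Fin n)) (f : C₀(Y, ℂ)) :
    ρ.endo (ρ.matUnit u v f) = (n : ℂ)⁻¹ • ∑ i, ∑ j, ρ.matUnit (i :: u) (j :: v) f := by
  simp only [endo, T_mul_matUnit_mul_star_T]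

end General

variable {n : ℕ} {X : Type u} [TopologicalSpace X] [T2Space X] {S : MultiSystem n X}
  {H : Type u} [NormedAddCommGroup H] [InnerProductSpace ℂ H] [CompleteSpace H]
  {ρ : RowRep S.cover H}

namespace IsCuntz

variable (hρ : ρ.IsCuntz)
include hρ

theorem monotone_level {I : ℕ → Submodule ℂ C₀(S.Tail, ℂ)}
    (hI : ∀ k, ∀ f ∈ I k, ∀ i, S.cover.pullback i f ∈ I (k + 1)) :
    Monotone fun k => ρ.level (I k) k :=
  monotone_nat_of_le_succ fun k => level_le fun u v hu hv f hf =>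
    hρ.matUnit_eq_sum u v f ▸ Submodule.sum_mem _ fun i _ =>
      matUnit_mem_level (by simp [hu]) (by simp [hv]) (hI k f hf i)

theorem mul_mem_level {I I' I'' : Submodule ℂ C₀(S.Tail, ℂ)}
    (h : ∀ f ∈ I, ∀ g ∈ I', f * g ∈ I'') {k : ℕ} {a b : H →L[ℂ] H} (ha : a ∈ ρ.level I k)
    (hb : b ∈ ρ.level I' k) : a * b ∈ ρ.level I'' k := by
  obtain ⟨f, hf, rfl⟩ := mem_level.1 ha
  obtain ⟨g, hg, rfl⟩ := mem_level.1 hb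
  exact mem_level.2 ⟨f * g, fun u v => I''.sum_mem fun p _ => h _ (hf u p) _ (hg p v),
    hρ.levelMap_mul f g⟩

end IsCuntz

end RowRep

/-! ### From closed sets to ideals -/

namespace MultiSystem

variable {n : ℕ} {X : Type u} [TopologicalSpace X] {S : MultiSystem n X} {F : Set S.Tail}

theorem IsShiftInvariant.image_shift_iterate_succ_subset (hF : S.IsShiftInvariant F) (k : ℕ) :
    S.shift^[k + 1] '' F ⊆ S.shift^[k] '' F := by
  rintro _ ⟨x, hx, rfl⟩
  exact ⟨S.shift x, hF x hx, rfl⟩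

variable [T2Space X]

theorem IsRobust.tailMap_mem_image_shift_iterate (hF : S.IsRobust F) {k : ℕ} {y : S.Tail}
    (hy : y ∈ S.shift^[k + 1] '' F) (i : Fin n) : S.tailMap i y ∈ S.shift^[k] '' F := by
  obtain ⟨x, hx, rfl⟩ := hy
  set w := S.initialWord k x
  have hlength : w.length = k := S.length_initialWord k x
  refine ⟨S.cover.wordMap (w ++ [i]) (S.shift^[k + 1] x), ?_, ?_⟩
  · simpa [hlength] using hF x hx (w ++ [i])
  · rw [wordMap_append]
    exact hlength ▸ S.shift_iterate_wordMap w (S.cover.wordMap [i] (S.shift^[k + 1] x))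

theorem IsRobust.pullback_mem_vanishingSubmodule (hF : S.IsRobust F) (k : ℕ) :
    ∀ f ∈ vanishingSubmodule (S.shift^[k] '' F), ∀ i,
      S.cover.pullback i f ∈ vanishingSubmodule (S.shift^[k + 1] '' F) :=
  fun _ hf i _ hy => hf _ (hF.tailMap_mem_image_shift_iterate hy i)

end MultiSystem

namespace RowRep

variable {n : ℕ} {X : Type u} [TopologicalSpace X] [T2Space X] {S : MultiSystem n X}
  {H : Type u} [NormedAddCommGroup H] [InnerProductSpace ℂ H] [CompleteSpace H]
  {ρ : RowRep S.cover H} {F : Set S.Tail}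

variable (ρ F) in
/-- The closed span of the elements `𝔱_u f 𝔱_v^*` with `|u| = |v|` and `f = 0` on `τ^{|u|}(F)`. -/
def idealOf : Submodule ℂ (H →L[ℂ] H) :=
  (⨆ k, ρ.level (vanishingSubmodule (S.shift^[k] '' F)) k).topologicalClosure

namespace IsCuntz

variable (hρ : ρ.IsCuntz)
include hρ

theorem exists_mem_level_of_mem_iSup {I : ℕ → Submodule ℂ C₀(S.Tail, ℂ)}
    (hI : ∀ k, ∀ f ∈ I k, ∀ i, S.cover.pullback i f ∈ I (k + 1)) {b : H →L[ℂ] H}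
    (hb : b ∈ ⨆ k, ρ.level (I k) k) : ∃ k, b ∈ ρ.level (I k) k :=
  (Submodule.mem_iSup_of_chain ⟨_, hρ.monotone_level hI⟩ b).1 hb

theorem mul_mem_iSup_level {I I' I'' : ℕ → Submodule ℂ C₀(S.Tail, ℂ)}
    (hI : ∀ k, ∀ f ∈ I k, ∀ i, S.cover.pullback i f ∈ I (k + 1))
    (hI' : ∀ k, ∀ f ∈ I' k, ∀ i, S.cover.pullback i f ∈ I' (k + 1))
    (h : ∀ k, ∀ f ∈ I k, ∀ g ∈ I' k, f * g ∈ I'' k) {a b : H →L[ℂ] H}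
    (ha : a ∈ ⨆ k, ρ.level (I k) k) (hb : b ∈ ⨆ k, ρ.level (I' k) k) :
    a * b ∈ ⨆ k, ρ.level (I'' k) k := by
  obtain ⟨k, hk⟩ := hρ.exists_mem_level_of_mem_iSup hI ha
  obtain ⟨l, hl⟩ := hρ.exists_mem_level_of_mem_iSup hI' hb
  exact Submodule.mem_iSup_of_mem (max k l) (hρ.mul_mem_level (h _)
    (hρ.monotone_level hI (le_max_left k l) hk) (hρ.monotone_level hI' (le_max_right k l) hl))

end IsCuntz

theorem idealOf_le_coreAlg : ρ.idealOf F ≤ ρ.coreAlg := by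
  rw [coreAlg_eq]
  exact Submodule.topologicalClosure_mono (iSup_mono fun k => level_le fun u v hu hv f _ =>
    matUnit_mem_level hu hv trivial)

theorem endo_mem_idealOf (hF : S.IsShiftInvariant F) {b : H →L[ℂ] H} (hb : b ∈ ρ.idealOf F) :
    ρ.endo b ∈ ρ.idealOf F := by
  have hmap : (⨆ k, ρ.level (vanishingSubmodule (S.shift^[k] '' F)) k) ≤
      (⨆ k, ρ.level (vanishingSubmodule (S.shift^[k] '' F)) k).comap
        ρ.endoCLM.toLinearMap := by
    refine iSup_le fun k => level_le fun u v hu hv f hf => ?_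
    rw [Submodule.mem_comap, ContinuousLinearMap.coe_coe, endoCLM_apply, endo_matUnit]
    refine Submodule.mem_iSup_of_mem (k + 1) (Submodule.smul_mem _ _ (Submodule.sum_mem _
      fun i _ => Submodule.sum_mem _ fun j _ => matUnit_mem_level (by simp [hu]) (by simp [hv]) ?_))
    exact fun y hy => hf y (hF.image_shift_iterate_succ_subset k hy)
  rw [← endoCLM_apply]
  exact map_mem_closure ρ.endoCLM.continuous hb hmap

theorem IsCuntz.isInvariantIdeal_idealOf (hρ : ρ.IsCuntz) (hF : S.IsRobust F)
    (hF' : S.IsShiftInvariant F) : ρ.IsInvariantIdeal (ρ.idealOf F) where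
  le := idealOf_le_coreAlg
  isClosed := Submodule.isClosed_topologicalClosure _
  mul_mem_left b hb x hx := by
    rw [coreAlg_eq] at hb
    exact map_mem_closure₂ continuous_mul hb hx fun a ha y hy =>
      hρ.mul_mem_iSup_level (I := fun _ => ⊤) (fun _ _ _ _ => trivial)
        hF.pullback_mem_vanishingSubmodule (fun _ f _ _ hg => mul_mem_vanishingSubmodule f hg) ha hy
  mul_mem_right b hb x hx := by
    rw [coreAlg_eq] at hb
    exact map_mem_closure₂ continuous_mul hx hb fun y hy a ha =>
      hρ.mul_mem_iSup_level (I' := fun _ => ⊤) hF.pullback_mem_vanishingSubmodule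
        (fun _ _ _ _ => trivial)
        (fun _ f hf g _ => mul_comm g f ▸ mul_mem_vanishingSubmodule g hf) hy ha
  endo_mem _ := endo_mem_idealOf hF'

/-- Compressing `π g - b` to the corner of `u`, where `u` is the initial word of `x` of length `k`,
removes `b` at `x`. -/
theorem IsCuntz.norm_apply_le_norm_sub_of_mem_level [LocallyCompactSpace X] (hρ : ρ.IsCuntz) {k : ℕ}
    {b : H →L[ℂ] H} (hb : b ∈ ρ.level (vanishingSubmodule (S.shift^[k] '' F)) k) {x : S.Tail}
    (hx : x ∈ F) (g : C₀(S.Tail, ℂ)) : ‖g x‖ ≤ ‖ρ.π g - b‖ := by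
  obtain ⟨f, hf, rfl⟩ := mem_level.1 hb
  set u : words n k := ⟨S.initialWord k x, mem_words.2 (S.length_initialWord k x)⟩
  set y := S.shift^[k] x
  have hux : S.cover.wordMap u y = x := S.wordMap_initialWord k x
  obtain ⟨e, hey, -, he⟩ := exists_zeroAtInfty_apply_eq_one isClosed_empty (Set.notMem_empty y)
  have hcompress : ρ.matUnit u u e * (ρ.π g - ρ.levelMap k f) * ρ.matUnit u u e =
      ρ.matUnit u u (e * S.cover.pullWord u g * e - e * f u u * e) := by
    rw [mul_sub, sub_mul, hρ.matUnit_mul_π_mul_matUnit, hρ.matUnit_mul_levelMap_mul_matUnit,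
      map_sub]
  have hue : ‖ρ.matUnit u u e‖ ≤ 1 := (ρ.norm_matUnit_le u u e).trans he
  calc ‖g x‖ = ‖(e * S.cover.pullWord u g * e - e * f u u * e) y‖ := by
        simp [MultiSystem.pullWord_apply, hux, hey, hf u u y ⟨x, hx, rfl⟩]
    _ ≤ ‖ρ.matUnit u u e * (ρ.π g - ρ.levelMap k f) * ρ.matUnit u u e‖ :=
        hcompress ▸ hρ.norm_apply_le_norm_matUnit_self u _ y
    _ ≤ ‖ρ.matUnit u u e‖ * ‖ρ.π g - ρ.levelMap k f‖ * ‖ρ.matUnit u u e‖ := norm_mul₃_le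
    _ ≤ 1 * ‖ρ.π g - ρ.levelMap k f‖ * 1 := by gcongr
    _ = ‖ρ.π g - ρ.levelMap k f‖ := by ring

theorem IsCuntz.interFun_idealOf [LocallyCompactSpace X] (hρ : ρ.IsCuntz) (hF : S.IsRobust F) :
    ρ.interFun (ρ.idealOf F) = vanishingIdeal F := by
  refine Set.Subset.antisymm (fun g hg x hx => ?_) fun g hg => ?_
  · refine norm_le_zero_iff.1 (le_of_forall_pos_lt_add fun ε hε => ?_)
    obtain ⟨b, hb, hgb⟩ := Metric.mem_closure_iff.1 hg ε hε
    obtain ⟨k, hk⟩ := hρ.exists_mem_level_of_mem_iSup hF.pullback_mem_vanishingSubmodule hb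
    rw [dist_eq_norm] at hgb
    simpa using (hρ.norm_apply_le_norm_sub_of_mem_level hk hx g).trans_lt hgb
  · refine Submodule.le_topologicalClosure _ (Submodule.mem_iSup_of_mem 0 ?_)
    rw [← matUnit_nil]
    refine matUnit_mem_level rfl rfl ?_
    rintro _ ⟨x, hx, rfl⟩
    exact hg x hx

end RowRep

/-! ### From ideals to closed sets -/

namespace RowRep

section General

variable {n : ℕ} {Y : Type u} [TopologicalSpace Y] {S : MultiSystem n Y}
  {H : Type u} [NormedAddCommGroup H] [InnerProductSpace ℂ H] [CompleteSpace H]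

/-- The set of common zeros of the functions in `J`. -/
def zeroSet (ρ : RowRep S H) (J : Submodule ℂ (H →L[ℂ] H)) : Set Y :=
  {y | ∀ f, ρ.π f ∈ J → f y = 0}

theorem isClosed_zeroSet (ρ : RowRep S H) (J : Submodule ℂ (H →L[ℂ] H)) :
    IsClosed (ρ.zeroSet J) := by
  simp only [zeroSet, Set.ofPred_forall]
  exact isClosed_iInter fun f => isClosed_iInter fun _ =>
    isClosed_eq (map_continuous f) continuous_const

variable {ρ : RowRep S H} {J : Submodule ℂ (H →L[ℂ] H)}

theorem IsInvariantIdeal.interFun_eq (hJ : ρ.IsInvariantIdeal J) :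
    ρ.interFun J = vanishingIdeal (ρ.zeroSet J) := by
  have hπ : Continuous ρ.π :=
    AddMonoidHomClass.continuous_of_bound ρ.π 1 fun f => by simpa using ρ.norm_π_le f
  refine closedIdeal_eq_vanishingIdeal
    (I := J.comap (ρ.π : C₀(Y, ℂ) →ₗ[ℂ] (H →L[ℂ] H))) (fun g f hf => ?_) (hJ.isClosed.preimage hπ)
  change ρ.π (g * f) ∈ J
  exact map_mul ρ.π g f ▸ hJ.mul_mem_left _ (ρ.π_mem_coreAlg g) _ hf

/-- Modulo `J`, `a = a * s = a * s ^ 2 = ⋯`, and these powers tend to `0`. -/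
theorem IsInvariantIdeal.mem_of_sub_mul_mem (hJ : ρ.IsInvariantIdeal J) {a s : H →L[ℂ] H}
    (hs : s ∈ ρ.coreAlg) (hs1 : ‖s‖ < 1) (has : a - a * s ∈ J) : a ∈ J := by
  have hpow (m : ℕ) : a - a * s ^ m ∈ J := by
    induction m with
    | zero => simp
    | succ m ih =>
      have hsplit : a - a * s ^ (m + 1) = (a - a * s) + (a - a * s ^ m) * s := by
        rw [pow_succ]
        noncomm_ring
      exact hsplit ▸ add_mem has (hJ.mul_mem_right _ hs _ ih)
  have hlim : Filter.Tendsto (fun m : ℕ => a - a * s ^ m) Filter.atTop (nhds a) := by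
    simpa using ((tendsto_pow_atTop_nhds_zero_of_norm_lt_one hs1).const_mul a).const_sub a
  exact hJ.isClosed.mem_of_tendsto hlim (Filter.Eventually.of_forall hpow)

end General

end RowRep

theorem exists_mul_eq_self_norm_smul_sub_mul_le {Y : Type u} [TopologicalSpace Y] [T2Space Y]
    [LocallyCompactSpace Y] (c : C₀(Y, ℂ)) (x : Y) {η : ℝ} (hη : 0 < η) :
    ∃ d e : C₀(Y, ℂ), d x = 1 ∧ d * e = d ∧ ‖e‖ ≤ 1 ∧ ‖c x • e - c * e‖ ≤ η := by
  have hclosed : IsClosed {z | η ≤ ‖c x - c z‖} :=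
    isClosed_le continuous_const (continuous_const.sub (map_continuous c)).norm
  obtain ⟨K, hK, hxK, hKη⟩ := exists_compact_subset (x := x) hclosed.isOpen_compl
    (by simpa using hη)
  obtain ⟨e, he1, he0, he, -⟩ := exists_zeroAtInfty_one_zero_of_isCompact hK hclosed
    (Set.disjoint_left.2 hKη)
  obtain ⟨d, hdx, hd0, -⟩ := exists_zeroAtInfty_apply_eq_one isOpen_interior.isClosed_compl
    (y := x) (t := (interior K)ᶜ) (not_not_intro hxK)
  refine ⟨d, e, hdx, ?_, he, (zeroAtInfty_norm_le hη.le).2 fun z => ?_⟩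
  · ext z
    by_cases hz : z ∈ interior K
    · simp [he1 (interior_subset hz)]
    · simp [hd0 hz]
  · have hfactor : (c x • e - c * e) z = (c x - c z) * e z := by
      simp [sub_mul]
    rw [hfactor, norm_mul]
    by_cases hz : η ≤ ‖c x - c z‖
    · simpa [he0 hz] using hη.le
    · calc ‖c x - c z‖ * ‖e z‖ ≤ η * 1 := by
            gcongr
            · exact (not_le.1 hz).le
            · exact (norm_zeroAtInfty_apply_le e z).trans he
        _ = η := mul_one η

namespace RowRep

variable {n : ℕ} {Y : Type u} [TopologicalSpace Y] [T2Space Y] [LocallyCompactSpace Y]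
  {S : MultiSystem n Y} {H : Type u} [NormedAddCommGroup H] [InnerProductSpace ℂ H]
  [CompleteSpace H] {ρ : RowRep S H} {J : Submodule ℂ (H →L[ℂ] H)}

/-- If the inequality failed, `π e` would be within distance less than `1` of `J` for some `e` equal
to `1` near `x`, so that `J` would contain functions that do not vanish at `x`. -/
theorem IsInvariantIdeal.norm_apply_le_norm_sub (hJ : ρ.IsInvariantIdeal J) {x : Y}
    (hx : x ∈ ρ.zeroSet J) (c : C₀(Y, ℂ)) {j : H →L[ℂ] H} (hj : j ∈ J) :
    ‖c x‖ ≤ ‖ρ.π c - j‖ := by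
  by_contra! hlt
  have hcx : c x ≠ 0 := norm_pos_iff.1 ((norm_nonneg _).trans_lt hlt)
  obtain ⟨d, e, hdx, hde, he, hce⟩ := exists_mul_eq_self_norm_smul_sub_mul_le c x
    (half_pos (sub_pos.2 hlt))
  have hjJ : (c x)⁻¹ • (j * ρ.π e) ∈ J :=
    J.smul_mem _ (hJ.mul_mem_right _ (ρ.π_mem_coreAlg e) _ hj)
  set s := ρ.π e - (c x)⁻¹ • (j * ρ.π e) with hs
  have hs_norm : ‖s‖ < 1 := by
    have hsmul : c x • s = ρ.π (c x • e - c * e) + (ρ.π c - j) * ρ.π e := by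
      rw [hs, smul_sub, smul_inv_smul₀ hcx, map_sub, map_smul, map_mul, sub_mul]
      abel
    refine (mul_lt_iff_lt_one_right (norm_pos_iff.2 hcx)).1 ?_
    calc ‖c x‖ * ‖s‖ = ‖ρ.π (c x • e - c * e) + (ρ.π c - j) * ρ.π e‖ := by
          rw [← norm_smul, hsmul]
      _ ≤ ‖c x • e - c * e‖ + ‖ρ.π c - j‖ * ‖e‖ :=
          norm_add_le_of_le (ρ.norm_π_le _) (norm_mul_le_of_le le_rfl (ρ.norm_π_le e))
      _ ≤ (‖c x‖ - ‖ρ.π c - j‖) / 2 + ‖ρ.π c - j‖ * 1 := by gcongr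
      _ < ‖c x‖ := by linarith
  have hsub : ρ.π d - ρ.π d * s ∈ J := by
    rw [hs, mul_sub, ← map_mul, hde, sub_sub_cancel]
    exact hJ.mul_mem_left _ (ρ.π_mem_coreAlg d) _ hjJ
  have hd : ρ.π d ∈ J :=
    hJ.mem_of_sub_mul_mem (sub_mem (ρ.π_mem_coreAlg e) (hJ.le hjJ)) hs_norm hsub
  exact one_ne_zero (hdx.symm.trans (hx d hd))

end RowRep

namespace RowRep

variable {n : ℕ} {X : Type u} [TopologicalSpace X] [T2Space X] {S : MultiSystem n X}
  {H : Type u} [NormedAddCommGroup H] [InnerProductSpace ℂ H] [CompleteSpace H]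
  {ρ : RowRep S.cover H} {J : Submodule ℂ (H →L[ℂ] H)}

theorem IsCuntz.matUnit_mul_endo_π_mul_matUnit (hρ : ρ.IsCuntz) (u v : List (Fin n)) (i j : Fin n)
    (a f b : C₀(S.Tail, ℂ)) :
    ρ.matUnit u [i] a * ρ.endo (ρ.π f) * ρ.matUnit [j] v b =
      (n : ℂ)⁻¹ • ρ.matUnit u v (a * f * b) := by
  have hword (p q : Fin n) (w w' : List (Fin n)) (g h : C₀(S.Tail, ℂ)) :
      ρ.matUnit w [p] g * ρ.matUnit [q] w' h = if p = q then ρ.matUnit w w' (g * h) else 0 := by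
    simp [hρ.matUnit_mul_matUnit]
  rw [← matUnit_nil, endo_matUnit]
  simp [Finset.mul_sum, Finset.sum_mul, hword]

variable [LocallyCompactSpace X]

namespace IsInvariantIdeal

variable (hJ : ρ.IsInvariantIdeal J) (hρ : ρ.IsCuntz)
include hJ hρ

theorem norm_apply_le_norm_matUnit_self_sub {u : List (Fin n)} {y : S.Tail}
    (hy : S.cover.wordMap u y ∈ ρ.zeroSet J) (f : C₀(S.Tail, ℂ)) {j : H →L[ℂ] H} (hj : j ∈ J) :
    ‖f y‖ ≤ ‖ρ.matUnit u u f - j‖ := by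
  rw [← S.pushWord_apply_wordMap u f y, hρ.matUnit_self]
  exact hJ.norm_apply_le_norm_sub hy _ hj

theorem apply_eq_zero_of_matUnit_self_mem {u : List (Fin n)} {y : S.Tail}
    (hy : S.cover.wordMap u y ∈ ρ.zeroSet J) {f : C₀(S.Tail, ℂ)} (hf : ρ.matUnit u u f ∈ J) :
    f y = 0 := by
  simpa using hJ.norm_apply_le_norm_matUnit_self_sub hρ hy f hf

theorem isRobust_zeroSet : S.IsRobust (ρ.zeroSet J) := by
  intro x hx w f hf
  set y := S.shift^[w.length] x
  set u := S.initialWord w.length x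
  have hul : u.length = w.length := S.length_initialWord _ _
  obtain ⟨e, hey, -, -⟩ := exists_zeroAtInfty_apply_eq_one isClosed_empty (Set.notMem_empty y)
  have hmem : ρ.matUnit u u (e * S.cover.pullWord w f * e) ∈ J := by
    rw [← hρ.matUnit_mul_π_mul_matUnit]
    exact hJ.mul_mem_right _ (matUnit_mem_coreAlg hul.symm e) _
      (hJ.mul_mem_left _ (matUnit_mem_coreAlg hul e) _ hf)
  have hux : S.cover.wordMap u y = x := S.wordMap_initialWord w.length x
  have hzero := hJ.apply_eq_zero_of_matUnit_self_mem hρ (hux.symm ▸ hx) hmem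
  simpa [hey, MultiSystem.pullWord_apply] using hzero

theorem isShiftInvariant_zeroSet : S.IsShiftInvariant (ρ.zeroSet J) := by
  intro x hx f hf
  set i := x.1.1 0
  have hn : (n : ℂ) ≠ 0 := Nat.cast_ne_zero.2 fun h => (h ▸ i : Fin 0).elim0
  obtain ⟨e, hex, -, -⟩ :=
    exists_zeroAtInfty_apply_eq_one isClosed_empty (Set.notMem_empty (S.shift x))
  have hei : ρ.matUnit [i] [i] e ∈ ρ.coreAlg := matUnit_mem_coreAlg rfl e
  have hmem : ρ.matUnit [i] [i] (e * f * e) ∈ J := by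
    rw [← J.smul_mem_iff (inv_ne_zero hn), ← hρ.matUnit_mul_endo_π_mul_matUnit]
    exact hJ.mul_mem_right _ hei _ (hJ.mul_mem_left _ hei _ (hJ.endo_mem _ hf))
  have hix : S.cover.wordMap [i] (S.shift x) = x := S.tailMap_shift x
  have hzero := hJ.apply_eq_zero_of_matUnit_self_mem hρ (hix.symm ▸ hx) hmem
  simpa [hex] using hzero

theorem idealOf_zeroSet_le : ρ.idealOf (ρ.zeroSet J) ≤ J := by
  refine Submodule.topologicalClosure_minimal _ (iSup_le fun k => level_le
    fun u v hu hv f hf => ?_) hJ.isClosed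
  have huJ : ρ.matUnit u u f ∈ J := by
    have hpush : S.pushWord u f ∈ ρ.interFun J := by
      rw [hJ.interFun_eq]
      intro x hx
      rcases S.pushWord_apply_eq_or u f x with h | h
      · exact h.trans (hf _ ⟨x, hx, by rw [hu]⟩)
      · exact h
    rwa [hρ.matUnit_self]
  refine hJ.isClosed.closure_subset (Metric.mem_closure_iff.2 fun ε hε => ?_)
  obtain ⟨e, he⟩ := exists_norm_sub_mul_self_le f (half_pos hε)
  refine ⟨ρ.matUnit u v (f * e), ?_, ?_⟩
  · rw [← hρ.matUnit_mul_matUnit_same u u v]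
    exact hJ.mul_mem_right _ (matUnit_mem_coreAlg (hu.trans hv.symm) e) _ huJ
  · rw [dist_eq_norm, ← map_sub]
    exact ((ρ.norm_matUnit_le u v _).trans he).trans_lt (half_lt_self hε)

end IsInvariantIdeal

end RowRep

/-! ### Reconstructing an ideal from its closed set -/

theorem exists_boundedContinuous_eq_zero_norm_one_sub_mul_le {Y : Type*} [TopologicalSpace Y]
    {N : Y → ℝ} (hN : Continuous N) {ε : ℝ} (hε : 0 < ε) :
    ∃ φ : BoundedContinuousFunction Y ℂ,
      (∀ y, N y ≤ ε → φ y = 0) ∧ ∀ y, ‖1 - φ y‖ * N y ≤ ε := by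
  have hmax (y : Y) : 0 < max (N y) ε := hε.trans_le (le_max_right _ _)
  let ψ : BoundedContinuousFunction Y ℂ := BoundedContinuousFunction.ofNormedAddCommGroup
    (fun y => ((ε / max (N y) ε : ℝ) : ℂ))
    (Complex.continuous_ofReal.comp (continuous_const.div (by fun_prop) fun y => (hmax y).ne')) 1
    fun y => by
      rw [Complex.norm_real, Real.norm_of_nonneg (div_nonneg hε.le (hmax y).le)]
      exact (div_le_one (hmax y)).2 (le_max_right _ _)
  refine ⟨1 - ψ, fun y hy => ?_, fun y => ?_⟩
  · simp [ψ, max_eq_right hy, hε.ne']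
  · calc ‖1 - (1 - ψ) y‖ * N y = ε / max (N y) ε * N y := by
          simp [ψ, abs_of_pos hε, abs_of_pos (hmax y)]
      _ ≤ ε / max (N y) ε * max (N y) ε := by
          gcongr
          exact le_max_left _ _
      _ = ε := div_mul_cancel₀ _ (hmax y).ne'

namespace RowRep

section General

variable {n : ℕ} {Y : Type u} [TopologicalSpace Y] {S : MultiSystem n Y}
  {H : Type u} [NormedAddCommGroup H] [InnerProductSpace ℂ H] [CompleteSpace H] (ρ : RowRep S H)

open scoped Matrix.Norms.L2Operator in
theorem exists_mem_level_vanishingSubmodule_norm_sub_le {k : ℕ}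
    {f : Matrix (words n k) (words n k) C₀(Y, ℂ)} {F : Set Y} {ε : ℝ} (hε : 0 < ε)
    (hf : ∀ y ∈ F, ‖f.map fun g => g y‖ ≤ ε) :
    ∃ b ∈ ρ.level (vanishingSubmodule F) k, ‖ρ.levelMap k f - b‖ ≤ ε := by
  have hcont : Continuous fun y => ‖f.map fun g => g y‖ :=
    continuous_norm.comp (continuous_matrix fun u v => map_continuous (f u v))
  obtain ⟨φ, hφ0, hφ⟩ := exists_boundedContinuous_eq_zero_norm_one_sub_mul_le hcont hε
  refine ⟨_, mem_level.2 ⟨f.map fun g => mulBounded g φ, fun u v y hy => ?_, rfl⟩, ?_⟩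
  · rw [Matrix.map_apply, mulBounded_apply, hφ0 y (hf y hy), mul_zero]
  · rw [← map_sub]
    refine ρ.norm_levelMap_le hε.le fun y => ?_
    have hsmul : ((f - f.map fun g => mulBounded g φ).map fun g => g y) =
        (1 - φ y) • f.map fun g => g y := by
      ext u v
      simp only [Matrix.map_apply, Matrix.sub_apply, Matrix.smul_apply, smul_eq_mul,
        ZeroAtInftyContinuousMap.coe_sub, Pi.sub_apply, mulBounded_apply]
      ring
    rw [hsmul, norm_smul]
    exact hφ y

/-- The row `∑ p, conj (ξ p) • 𝔱_u e 𝔱_p^*`. Multiplying by such rows from the left and their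
adjoints from the right compresses the elements of level `k` to the corner of `u`. -/
def compressRow (u : List (Fin n)) (e : C₀(Y, ℂ)) {k : ℕ} (ξ : EuclideanSpace ℂ (words n k)) :
    H →L[ℂ] H :=
  ∑ p : words n k, star (ξ p) • ρ.matUnit u p e

theorem norm_compressRow_le (u : List (Fin n)) (e : C₀(Y, ℂ)) {k : ℕ}
    (ξ : EuclideanSpace ℂ (words n k)) : ‖ρ.compressRow u e ξ‖ ≤ ‖e‖ * ‖ξ‖ :=
  calc ‖ρ.compressRow u e ξ‖
      = ‖ρ.word u * ρ.π e * ∑ p : words n k, star (ξ p) • star (ρ.word p)‖ := by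
        simp only [compressRow, matUnit_apply, Finset.mul_sum, mul_smul_comm]
    _ ≤ ‖e‖ * ‖ξ‖ :=
        norm_mul_le_of_le (ρ.norm_word_mul_π_le u e) (ρ.norm_sum_smul_star_word_le ξ)

theorem star_compressRow (u : List (Fin n)) (e : C₀(Y, ℂ)) {k : ℕ}
    (ξ : EuclideanSpace ℂ (words n k)) :
    star (ρ.compressRow u e ξ) = ∑ p : words n k, ξ p • ρ.matUnit p u (star e) := by
  simp only [compressRow, star_sum, star_smul, star_star, star_matUnit]

variable {u : List (Fin n)} {k : ℕ}

theorem compressRow_mem_coreAlg (hu : u.length = k) (e : C₀(Y, ℂ))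
    (ξ : EuclideanSpace ℂ (words n k)) : ρ.compressRow u e ξ ∈ ρ.coreAlg :=
  Submodule.sum_mem _ fun p _ => Submodule.smul_mem _ _
    (matUnit_mem_coreAlg (hu.trans (mem_words.1 p.2).symm) e)

theorem star_compressRow_mem_coreAlg (hu : u.length = k) (e : C₀(Y, ℂ))
    (ξ : EuclideanSpace ℂ (words n k)) : star (ρ.compressRow u e ξ) ∈ ρ.coreAlg := by
  rw [star_compressRow]
  exact Submodule.sum_mem _ fun p _ => Submodule.smul_mem _ _
    (matUnit_mem_coreAlg ((mem_words.1 p.2).trans hu.symm) (star e))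

end General

variable {n : ℕ} {X : Type u} [TopologicalSpace X] [T2Space X] {S : MultiSystem n X}
  {H : Type u} [NormedAddCommGroup H] [InnerProductSpace ℂ H] [CompleteSpace H]
  {ρ : RowRep S.cover H} {J : Submodule ℂ (H →L[ℂ] H)}

theorem IsCuntz.compressRow_mul_levelMap_mul_star_compressRow (hρ : ρ.IsCuntz) (u : List (Fin n))
    (e : C₀(S.Tail, ℂ)) {k : ℕ} (ξ η : EuclideanSpace ℂ (words n k))
    (f : Matrix (words n k) (words n k) C₀(S.Tail, ℂ)) :
    ρ.compressRow u e ξ * ρ.levelMap k f * star (ρ.compressRow u e η) =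
      ρ.matUnit u u (∑ p, ∑ q, (star (ξ p) * η q) • (e * f p q * star e)) := by
  rw [star_compressRow, compressRow]
  simp only [Finset.sum_mul, smul_mul_assoc]
  rw [map_sum]
  refine Finset.sum_congr rfl fun p _ => ?_
  simp only [Finset.mul_sum, Finset.smul_sum, mul_smul_comm,
    hρ.matUnit_mul_levelMap_mul_matUnit, map_sum, map_smul, smul_smul]

namespace IsInvariantIdeal

variable [LocallyCompactSpace X] (hJ : ρ.IsInvariantIdeal J) (hρ : ρ.IsCuntz)
include hJ hρ

open scoped Matrix.Norms.L2Operator in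
theorem norm_map_apply_le_norm_levelMap_sub {k : ℕ}
    (f : Matrix (words n k) (words n k) C₀(S.Tail, ℂ)) {j : H →L[ℂ] H} (hj : j ∈ J) {y : S.Tail}
    (hy : y ∈ S.shift^[k] '' ρ.zeroSet J) : ‖f.map fun g => g y‖ ≤ ‖ρ.levelMap k f - j‖ := by
  obtain ⟨x, hx, rfl⟩ := hy
  set y := S.shift^[k] x
  set u := S.initialWord k x
  have hu : u.length = k := S.length_initialWord k x
  have hux : S.cover.wordMap u y ∈ ρ.zeroSet J := (S.wordMap_initialWord k x).symm ▸ hx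
  obtain ⟨e, hey, -, he⟩ := exists_zeroAtInfty_apply_eq_one isClosed_empty (Set.notMem_empty y)
  rw [← Matrix.l2_opNorm_toEuclideanCLM]
  refine opNorm_le_of_norm_inner_le (norm_nonneg _) fun η ξ => ?_
  set A := ρ.compressRow u e ξ
  set B := star (ρ.compressRow u e η)
  have hA : ‖A‖ ≤ ‖ξ‖ := (ρ.norm_compressRow_le u e ξ).trans
    (mul_le_of_le_one_left (norm_nonneg ξ) he)
  have hB : ‖B‖ ≤ ‖η‖ := (norm_star _).trans_le <| (ρ.norm_compressRow_le u e η).trans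
    (mul_le_of_le_one_left (norm_nonneg η) he)
  have hAjB : A * j * B ∈ J := hJ.mul_mem_right _ (ρ.star_compressRow_mem_coreAlg hu e η) _
    (hJ.mul_mem_left _ (ρ.compressRow_mem_coreAlg hu e ξ) _ hj)
  set g := ∑ p, ∑ q, (star (ξ p) * η q) • (e * f p q * star e)
  have hgy : inner ℂ ξ (Matrix.toEuclideanCLM (𝕜 := ℂ) (f.map fun h => h y) η) = g y := by
    simp only [PiLp.inner_apply, RCLike.inner_apply, Matrix.ofLp_toEuclideanCLM, Matrix.mulVec,
      dotProduct, Matrix.map_apply, g, zeroAtInfty_sum_apply, Finset.sum_mul]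
    refine Finset.sum_congr rfl fun p _ => Finset.sum_congr rfl fun q _ => ?_
    simp only [ZeroAtInftyContinuousMap.coe_smul, ZeroAtInftyContinuousMap.coe_mul,
      ZeroAtInftyContinuousMap.coe_star, Pi.smul_apply, Pi.mul_apply, Pi.star_apply, smul_eq_mul,
      RCLike.star_def, hey, star_one, one_mul, mul_one]
    ring
  calc ‖inner ℂ ξ (Matrix.toEuclideanCLM (𝕜 := ℂ) (f.map fun h => h y) η)‖
      ≤ ‖ρ.matUnit u u g - A * j * B‖ :=
        hgy ▸ hJ.norm_apply_le_norm_matUnit_self_sub hρ hux g hAjB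
    _ = ‖A * (ρ.levelMap k f - j) * B‖ := by
        rw [← hρ.compressRow_mul_levelMap_mul_star_compressRow, ← sub_mul, ← mul_sub]
    _ ≤ ‖A‖ * ‖ρ.levelMap k f - j‖ * ‖B‖ := norm_mul₃_le
    _ ≤ ‖ξ‖ * ‖ρ.levelMap k f - j‖ * ‖η‖ := by gcongr
    _ = ‖ρ.levelMap k f - j‖ * ‖η‖ * ‖ξ‖ := by ring

theorem le_idealOf_zeroSet : J ≤ ρ.idealOf (ρ.zeroSet J) := by
  intro j hj
  refine Metric.mem_closure_iff.2 fun δ hδ => ?_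
  have hjcore := hJ.le hj
  rw [coreAlg_eq] at hjcore
  obtain ⟨b, hb, hjb⟩ := Metric.mem_closure_iff.1 hjcore (δ / 2) (half_pos hδ)
  obtain ⟨k, hk⟩ := hρ.exists_mem_level_of_mem_iSup (I := fun _ => ⊤) (fun _ _ _ _ => trivial) hb
  obtain ⟨f, -, rfl⟩ := mem_level.1 hk
  have hf (y : S.Tail) (hy : y ∈ S.shift^[k] '' ρ.zeroSet J) :=
    (hJ.norm_map_apply_le_norm_levelMap_sub hρ f hj hy).trans
      (dist_eq_norm_sub' j (ρ.levelMap k f) ▸ hjb.le)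
  obtain ⟨c, hc, hbc⟩ := ρ.exists_mem_level_vanishingSubmodule_norm_sub_le (half_pos hδ) hf
  refine ⟨c, Submodule.mem_iSup_of_mem k hc, ?_⟩
  calc dist j c ≤ dist j (ρ.levelMap k f) + dist (ρ.levelMap k f) c := dist_triangle _ _ _
    _ < δ / 2 + δ / 2 := add_lt_add_of_lt_of_le hjb ((dist_eq_norm _ _).trans_le hbc)
    _ = δ := add_halves δ

theorem idealOf_zeroSet : ρ.idealOf (ρ.zeroSet J) = J :=
  (hJ.idealOf_zeroSet_le hρ).antisymm (hJ.le_idealOf_zeroSet hρ)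

end IsInvariantIdeal

end RowRep

end

theorem lemmaL_general {n : ℕ} {X : Type u} [TopologicalSpace X] [T2Space X]
    [LocallyCompactSpace X] (S : MultiSystem n X)
    {H : Type u} [NormedAddCommGroup H] [InnerProductSpace ℂ H] [CompleteSpace H]
    (ρ : RowRep S.cover H) (hρ : ρ.IsCStarEnvelope) :
    ∃ Φ : {J : Submodule ℂ (H →L[ℂ] H) // ρ.IsInvariantIdeal J} →
        {F : Set S.Tail // IsClosed F ∧ S.IsRobust F ∧ S.IsShiftInvariant F},
      Function.Bijective Φ ∧
      ∀ (J : {J : Submodule ℂ (H →L[ℂ] H) // ρ.IsInvariantIdeal J}) (F : Set S.Tail),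
        IsClosed F → (ρ.interFun J.1 = vanishingIdeal F ↔ F = (Φ J).1) := by
  have hc := hρ.isCuntz
  refine ⟨fun J => ⟨ρ.zeroSet J.1, ρ.isClosed_zeroSet J.1, J.2.isRobust_zeroSet hc,
    J.2.isShiftInvariant_zeroSet hc⟩, ⟨fun J K hJK => Subtype.ext ?_, fun F => ?_⟩,
    fun J F hF => ?_⟩
  · calc J.1 = ρ.idealOf (ρ.zeroSet J.1) := (J.2.idealOf_zeroSet hc).symm
      _ = ρ.idealOf (ρ.zeroSet K.1) := congrArg ρ.idealOf (congrArg Subtype.val hJK)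
      _ = K.1 := K.2.idealOf_zeroSet hc
  · have hJ := hc.isInvariantIdeal_idealOf F.2.2.1 F.2.2.2
    refine ⟨⟨ρ.idealOf F.1, hJ⟩, Subtype.ext ?_⟩
    refine vanishingIdeal_injOn_isClosed (ρ.isClosed_zeroSet _) F.2.1 ?_
    rw [← hJ.interFun_eq, hc.interFun_idealOf F.2.2.1]
  · rw [J.2.interFun_eq]
    exact ⟨fun h => (vanishingIdeal_injOn_isClosed (ρ.isClosed_zeroSet _) hF h).symm,
      fun h => congrArg vanishingIdeal h.symm⟩

theorem lemmaL {n : ℕ} {X : Type u} [TopologicalSpace X] [T2Space X] [LocallyCompactSpace X]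
    (S : MultiSystem n X) (hS : S.IsSurjective)
    {H : Type u} [NormedAddCommGroup H] [InnerProductSpace ℂ H] [CompleteSpace H]
    (ρ : RowRep S.cover H) (hρ : ρ.IsCStarEnvelope) :
    ∃ Φ : {J : Submodule ℂ (H →L[ℂ] H) // ρ.IsInvariantIdeal J} →
        {F : Set S.Tail // IsClosed F ∧ S.IsRobust F ∧ S.IsShiftInvariant F},
      Function.Bijective Φ ∧
      ∀ (J : {J : Submodule ℂ (H →L[ℂ] H) // ρ.IsInvariantIdeal J}) (F : Set S.Tail),
        IsClosed F → (ρ.interFun J.1 = vanishingIdeal F ↔ F = (Φ J).1) :=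
  lemmaL_general S ρ hρ
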